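/- **Setting (generalized BB84 protocol).** Let $N,n,r,m\ge 0$ be integers with $r+m\le n<N$. Bit strings are row vectors over $\mathbf F_2$; $\oplus$ is addition and $|\mathbf x|$ is the number of $1$-bits of $\mathbf x$. For $i,b\in\{0,1\}$ let $|i\rangle_0$ be the computational basis of a qubit, $|i\rangle_1=(|0\rangle_0+(-1)^i|1\rangle_0)/\sqrt2$, and $|\mathbf i\rangle_{\mathbf b}=\bigotimes_{p=1}^N|i_p\rangle_{b_p}$ for $\mathbf i,\mathbf b\in\mathbf F_2^N$. Alice chooses $\mathbf i\in\mathbf F_2^N$ uniformly; $(\mathbf b,\mathbf s)\in\mathbf F_2^N\times\mathbf F_2^N$ with $|\mathbf s|=n$ from an arbitrary given probability distribution; and $(P_{\mathrm C},P_{\mathrm K})\in\mathbf F_2^{r\times n}\times\mathbf F_2^{m\times n}$ uniformly among the pairs whose $r+m$ rows together are linearly independent; the three choices are independent. The substring of $\mathbf x$ at the $n$ positions where $s_p=1$ (INFO bits) is $\mathbf x_{\mathrm I}$, and the one at the $N-n$ positions where $s_p=0$ (TEST bits) is $\mathbf x_{\mathrm T}$. Alice sends $|\mathbf i\rangle_{\mathbf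 b}$, and Bob measures the qubits he receives in the basis $\{|\mathbf j\rangle_{\mathbf b}\}_{\mathbf j}$, obtaining $\mathbf j$. In the hypothetical *inverted-INFO-basis* protocol everything is the same, except that Alice and Bob use the basis string $\mathbf b^0=\mathbf b\oplus\mathbf s$ instead of $\mathbf b$. **Attack.** A joint attack consists of a probe Hilbert space $\mathrm E$, a unit vector $|0\rangle_{\mathrm E}$ and a unitary $U$ on the tensor product of $\mathrm E$ and the $N$-qubit space; write $U|0\rangle_{\mathrm E}|\mathbf i\rangle_{\mathbf b}=\sum_{\mathbf j}|E'_{\mathbf i,\mathbf j}\rangle_{\mathbf b}|\mathbf j\rangle_{\mathbf b}$, so that $\Pr(\mathbf j\mid\mathbf i,\mathbf b,\mathbf s)=\|E'_{\mathbf i,\mathbf j}\|_{\mathbf b}^2$ in the real protocol (and the same with $\mathbf b^0$ in place of $\mathbf b$ in the hypothetical one). Its *symmetrized attack* uses the probe $\mathrm E\otimes\mathrm M$, where $\mathrm M$ is an $N$-qubit register initially in the state $2^{-N/2}\sum_{\mathbf m}|\mathbf m\rangle$, and the unitary $U^{\mathrm{sym}}=(I_{\mathrm E}\otimes S^\dagger)(U\otimes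 I_{\mathrm M})(I_{\mathrm E}\otimes S)$, where $S|\mathbf i\rangle_{\mathbf b}|\mathbf m\rangle_{\mathrm M}=(-1)^{(\mathbf i\oplus\mathbf b)\cdot\mathbf m}|\mathbf i\oplus\mathbf m\rangle_{\mathbf b}|\mathbf m\rangle_{\mathrm M}$. The superscript $\mathrm{sym}$ means that all quantities are computed for the symmetrized attack. **Eve's states.** Fix $\mathbf i_{\mathrm T},\mathbf j_{\mathrm T},\mathbf b,\mathbf s$ with $\Pr^{\mathrm{sym}}(\mathbf i_{\mathrm T},\mathbf j_{\mathrm T},\mathbf b,\mathbf s)>0$ and $\boldsymbol\xi\in\mathbf F_2^r$. Put $$(\rho^{\mathbf i_{\mathrm I}})_{\mathrm E}^{\mathrm{sym}}=\sum_{\mathbf j_{\mathrm I}\in\mathbf F_2^n}\frac{|E'^{\,\mathrm{sym}}_{\mathbf i,\mathbf j}\rangle_{\mathbf b}\langle E'^{\,\mathrm{sym}}_{\mathbf i,\mathbf j}|_{\mathbf b}}{\Pr^{\mathrm{sym}}(\mathbf j_{\mathrm T}\mid\mathbf i_{\mathrm I},\mathbf i_{\mathrm T},\mathbf b,\mathbf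 s)},$$ where $\mathbf i,\mathbf j$ are the strings with INFO bits $\mathbf i_{\mathrm I},\mathbf j_{\mathrm I}$ and TEST bits $\mathbf i_{\mathrm T},\mathbf j_{\mathrm T}$, and for a key $\mathbf k\in\mathbf F_2^m$ put $$\widehat\rho^{\,\mathrm{sym}}_{\mathbf k}=\frac1{2^{n-r-m}}\sum_{\substack{P_{\mathrm C},P_{\mathrm K},\mathbf i_{\mathrm I}\\ \mathbf i_{\mathrm I}P_{\mathrm C}^{\mathsf T}=\boldsymbol\xi,\ \mathbf i_{\mathrm I}P_{\mathrm K}^{\mathsf T}=\mathbf k}}\Pr(P_{\mathrm C},P_{\mathrm K})\,(\rho^{\mathbf i_{\mathrm I}})_{\mathrm E}^{\mathrm{sym}}\otimes|P_{\mathrm C},P_{\mathrm K}\rangle\langle P_{\mathrm C},P_{\mathrm K}|,$$ where the states $|P_{\mathrm C},P_{\mathrm K}\rangle$ are orthonormal. **Proposition.** For any two keys $\mathbf k,\mathbf k'\in\mathbf F_2^m$, any symmetrized attack, and any integer $0\le t\le\frac n2$, $$\tfrac12\operatorname{tr}\bigl|\widehat\rho^{\,\mathrm{sym}}_{\mathbf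 k}-\widehat\rho^{\,\mathrm{sym}}_{\mathbf k'}\bigr|\le 2m\sqrt{\Pr\nolimits^{\mathrm{sym}}_{\text{inverted-INFO-basis}}\bigl[\,|\mathbf C_{\mathrm I}|\ge t\ \bigm|\ \mathbf i_{\mathrm T},\mathbf j_{\mathrm T},\mathbf b,\mathbf s\bigr]+2^{\,n[H_2(t/n)-(n-r-m)/n]}},$$ where $\mathbf C_{\mathrm I}$ is the random variable $\mathbf i_{\mathrm I}\oplus\mathbf j_{\mathrm I}$ and $H_2(x)=-x\log_2x-(1-x)\log_2(1-x)$ with $0\log_20=0$. (For $n=0$ one has $m=0$, and both sides are $0$.) -/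

import Mathlib

open scoped InnerProductSpace ENNReal Matrix

noncomputable section

namespace BB84

/-! ### Bit strings -/

/-- Bit strings of length `N`: row vectors over `𝔽₂`; addition is XOR, and the number of
`1`-bits of `x` is `hammingNorm x`. -/
abbrev Bits (N : ℕ) : Type := Fin N → ZMod 2

/-- The sign `(-1)^{x · y}`. -/
def sgn {N : ℕ} (x y : Bits N) : ℂ := (-1) ^ (x ⬝ᵥ y).val

/-- The strings `s` of length `N` with `|s| = n`: the INFO positions are those with `s_p = 1`,
the TEST positions are those with `s_p = 0`. -/
abbrev InfoString (N n : ℕ) : Type := {s : Bits N // hammingNorm s = n}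

namespace InfoString

variable {N n : ℕ} (s : InfoString N n)

/-- The set of INFO positions. -/
def infoSet : Finset (Fin N) := Finset.univ.filter fun p => s.1 p ≠ 0

/-- The set of TEST positions. -/
def testSet : Finset (Fin N) := Finset.univ.filter fun p => s.1 p = 0

theorem card_infoSet : s.infoSet.card = n := s.2

theorem card_testSet : s.testSet.card = N - n := by
  have h := Finset.card_filter_add_card_filter_not (s := (Finset.univ : Finset (Fin N)))
    (fun p => s.1 p ≠ 0)
  have h1 : (Finset.univ.filter fun p => s.1 p ≠ 0).card = n := s.2
  simp only [not_not, Finset.card_univ, Fintype.card_fin] at h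
  unfold testSet
  omega

/-- The increasing enumeration of the INFO positions. -/
def infoIso : Fin n ≃o s.infoSet := s.infoSet.orderIsoOfFin s.card_infoSet

/-- The increasing enumeration of the TEST positions. -/
def testIso : Fin (N - n) ≃o s.testSet := s.testSet.orderIsoOfFin s.card_testSet

/-- The substring `x_I` of the INFO bits of `x`. -/
def info (x : Bits N) : Bits n := fun a => x (s.infoIso a)

/-- The substring `x_T` of the TEST bits of `x`. -/
def test (x : Bits N) : Bits (N - n) := fun a => x (s.testIso a)

/-- The string with given INFO bits and TEST bits. -/
def merge (xI : Bits n) (xT : Bits (N - n)) : Bits N := fun p =>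
  if h : s.1 p ≠ 0 then xI (s.infoIso.symm ⟨p, by simp [infoSet, h]⟩)
  else xT (s.testIso.symm ⟨p, by simpa [testSet] using h⟩)

theorem info_merge (xI : Bits n) (xT : Bits (N - n)) : s.info (s.merge xI xT) = xI := by
  funext a
  have h : s.1 (s.infoIso a) ≠ 0 := (Finset.mem_filter.1 (s.infoIso a).2).2
  simp [info, merge, h]

theorem test_merge (xI : Bits n) (xT : Bits (N - n)) : s.test (s.merge xI xT) = xT := by
  funext a
  have h : s.1 (s.testIso a) = 0 := (Finset.mem_filter.1 (s.testIso a).2).2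
  simp [test, merge, h]

end InfoString

/-! ### Quantum systems and operators -/

/-- The Hilbert space `K ⊗ ℂ^X`, for a Hilbert space `K` and a finite set `X`: the vector `ψ`
stands for `∑ x, ψ x ⊗ |x⟩`. -/
abbrev Composite (K X : Type*) : Type _ := PiLp 2 fun _ : X => K

section Operators

variable {K X : Type*} [NormedAddCommGroup K] [InnerProductSpace ℂ K] [Fintype X]

/-- The product vector `v ⊗ q`. -/
def tensorVec (v : K) (q : EuclideanSpace ℂ X) : Composite K X := WithLp.toLp 2 fun x => q x • v

/-- The partial inner product `(I ⊗ ⟨q|) ψ`. -/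
def partialInner (q : EuclideanSpace ℂ X) (ψ : Composite K X) : K :=
  ∑ x, (starRingEnd ℂ) (q x) • ψ x

/-- The operator `T ⊗ |x⟩⟨x|`. -/
def tensorProj [DecidableEq X] (T : K →L[ℂ] K) (x : X) : Composite K X →L[ℂ] Composite K X :=
  ((PiLp.continuousLinearEquiv 2 ℂ fun _ : X => K).symm.toContinuousLinearMap ∘L
    ContinuousLinearMap.single ℂ (fun _ : X => K) x) ∘L T ∘L PiLp.proj 2 (fun _ : X => K) x

/-- `tr |T|`, where `|T| = √(T* T)` and the trace is taken in a Hilbert basis of the space. -/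
def traceNorm [CompleteSpace K] (T : K →L[ℂ] K) : ℝ≥0∞ :=
  ∑' e : (exists_hilbertBasis ℂ K).choose,
    ENNReal.ofReal (RCLike.re ⟪(e : K), (CFC.abs T) (e : K)⟫_ℂ)

end Operators

/-- `⟨x | i⟩_b` for a single qubit: `|i⟩₀` is the computational basis,
`|i⟩₁ = (|0⟩₀ + (-1)^i |1⟩₀) / √2` is the Hadamard basis. -/
def qubitAmp (b i x : ZMod 2) : ℂ :=
  if b = 0 then (if x = i then 1 else 0) else (-1) ^ (i * x).val / (Real.sqrt 2 : ℂ)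

/-- The `N`-qubit state `|i⟩_b = ⊗_p |i_p⟩_{b_p}`. -/
def ket {N : ℕ} (b i : Bits N) : EuclideanSpace ℂ (Bits N) :=
  WithLp.toLp 2 fun x => ∏ p, qubitAmp (b p) (i p) (x p)

/-! ### Attacks -/

/-- A joint attack on `N` qubits with probe space `H`: an initial state of the probe and a
unitary operator on the compound system of the probe and the qubits. -/
structure Attack (N : ℕ) (H : Type*) [NormedAddCommGroup H] [InnerProductSpace ℂ H] where
  probe : H
  norm_probe : ‖probe‖ = 1
  unitary : Composite H (Bits N) ≃ₗᵢ[ℂ] Composite H (Bits N)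

theorem sgn_mul_self {N : ℕ} (x y : Bits N) : sgn x y * sgn x y = 1 := by
  rw [sgn, ← mul_pow]
  simp

theorem norm_sgn {N : ℕ} (x y : Bits N) : ‖sgn x y‖ = 1 := by
  simp [sgn]

theorem bits_add_self {N : ℕ} (x : Bits N) : x + x = 0 := by
  funext p
  exact CharTwo.add_self_eq_zero (x p)

theorem norm_sq_composite₂ {X Y H : Type*} [Fintype X] [Fintype Y] [NormedAddCommGroup H]
    [InnerProductSpace ℂ H] (ψ : Composite (Composite H Y) X) :
    ‖ψ‖ ^ 2 = ∑ x, ∑ y, ‖ψ x y‖ ^ 2 := by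
  rw [PiLp.norm_sq_eq_of_L2]
  exact Finset.sum_congr rfl fun x _ => PiLp.norm_sq_eq_of_L2 _ (ψ x)

/-- The unitary `S` acting on the qubits and on the additional probe `M` (an `N`-qubit register)
by `S |i⟩₀ |m⟩ = (-1)^{i · m} |i ⊕ m⟩₀ |m⟩`, tensored with the identity of `H`; a vector `ψ`
stands for `∑ x m, ψ x m ⊗ |m⟩_M ⊗ |x⟩₀`. -/
def symmetrizer (N : ℕ) (H : Type*) [NormedAddCommGroup H] [InnerProductSpace ℂ H] :
    Composite (Composite H (Bits N)) (Bits N) ≃ₗᵢ[ℂ] Composite (Composite H (Bits N)) (Bits N) where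
  toFun ψ := WithLp.toLp 2 fun x => WithLp.toLp 2 fun m => sgn (x + m) m • ψ (x + m) m
  invFun ψ := WithLp.toLp 2 fun x => WithLp.toLp 2 fun m => sgn x m • ψ (x + m) m
  map_add' ψ φ := by ext x m; simp
  map_smul' c ψ := by ext x m; simp [smul_comm c]
  left_inv ψ := by
    ext x m
    simp [smul_smul, add_assoc, bits_add_self, sgn_mul_self]
  right_inv ψ := by
    ext x m
    simp [smul_smul, add_assoc, bits_add_self, sgn_mul_self]
  norm_map' ψ := by
    rw [← sq_eq_sq₀ (norm_nonneg _) (norm_nonneg _), norm_sq_composite₂, norm_sq_composite₂,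
      Finset.sum_comm, Finset.sum_comm (f := fun x m => ‖ψ x m‖ ^ 2)]
    refine Finset.sum_congr rfl fun m _ => ?_
    refine Fintype.sum_equiv (Equiv.addRight m) _ _ fun x => ?_
    simp [norm_smul, norm_sgn]

theorem bit_cases : ∀ a : ZMod 2, a = 0 ∨ a = 1 := by decide

theorem neg_one_pow_val_add (a b : ZMod 2) :
    (-1 : ℂ) ^ (a + b).val = (-1) ^ a.val * (-1) ^ b.val := by
  have h : (1 : ZMod 2) + 1 = 0 := rfl
  have h1 : (1 : ZMod 2).val = 1 := rfl
  rcases bit_cases a with rfl | rfl <;> rcases bit_cases b with rfl | rfl <;> simp [h, h1]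

theorem sgn_eq_prod {N : ℕ} (x y : Bits N) : sgn x y = ∏ p, (-1 : ℂ) ^ (x p * y p).val := by
  have h : ∀ F : Finset (Fin N), (-1 : ℂ) ^ (∑ p ∈ F, x p * y p).val =
      ∏ p ∈ F, (-1 : ℂ) ^ (x p * y p).val := by
    intro F
    induction F using Finset.induction_on with
    | empty => simp
    | insert a F ha ih => rw [Finset.sum_insert ha, Finset.prod_insert ha, neg_one_pow_val_add, ih]
  exact h Finset.univ

theorem qubitAmp_shift (b i x m : ZMod 2) :
    (-1 : ℂ) ^ ((x + m) * m).val * qubitAmp b i (x + m) =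
      (-1) ^ ((i + b) * m).val * qubitAmp b (i + m) x := by
  have h : (1 : ZMod 2) + 1 = 0 := rfl
  have h1 : (1 : ZMod 2).val = 1 := rfl
  rcases bit_cases b with rfl | rfl <;> rcases bit_cases i with rfl | rfl <;>
    rcases bit_cases x with rfl | rfl <;> rcases bit_cases m with rfl | rfl <;>
    simp [qubitAmp, h, h1, neg_div]

/-- In every basis `b`, `S |i⟩_b |m⟩ = (-1)^{(i ⊕ b) · m} |i ⊕ m⟩_b |m⟩`. -/
theorem symmetrizer_ket {N : ℕ} {H : Type*} [NormedAddCommGroup H] [InnerProductSpace ℂ H]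
    (v : H) (b i m : Bits N) :
    symmetrizer N H (tensorVec (tensorVec v (EuclideanSpace.single m 1)) (ket b i)) =
      sgn (i + b) m • tensorVec (tensorVec v (EuclideanSpace.single m 1)) (ket b (i + m)) := by
  have key : ∀ x : Bits N, sgn (x + m) m * ket b i (x + m) = sgn (i + b) m * ket b (i + m) x := by
    intro x
    simp only [sgn_eq_prod, ket, ← Finset.prod_mul_distrib]
    exact Finset.prod_congr rfl fun p _ => qubitAmp_shift (b p) (i p) (x p) (m p)
  ext x m'
  change sgn (x + m') m' • ket b i (x + m') •
      (EuclideanSpace.single m (1 : ℂ) : EuclideanSpace ℂ (Bits N)) m' • v =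
    sgn (i + b) m • ket b (i + m) x •
      (EuclideanSpace.single m (1 : ℂ) : EuclideanSpace ℂ (Bits N)) m' • v
  by_cases hm : m' = m
  · rw [hm, smul_smul (sgn _ _), smul_smul (sgn _ _), key]
  · simp [hm]

/-- The operator `U ⊗ I_M`. -/
def extendByRegister {N : ℕ} {H : Type*} [NormedAddCommGroup H] [InnerProductSpace ℂ H]
    (U : Composite H (Bits N) ≃ₗᵢ[ℂ] Composite H (Bits N)) :
    Composite (Composite H (Bits N)) (Bits N) ≃ₗᵢ[ℂ] Composite (Composite H (Bits N)) (Bits N) where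
  toFun ψ := WithLp.toLp 2 fun x => WithLp.toLp 2 fun m => U (WithLp.toLp 2 fun y => ψ y m) x
  invFun ψ := WithLp.toLp 2 fun x => WithLp.toLp 2 fun m => U.symm (WithLp.toLp 2 fun y => ψ y m) x
  map_add' ψ φ := by
    ext x m
    have h : (WithLp.toLp 2 fun y => (ψ + φ) y m : Composite H (Bits N)) =
        WithLp.toLp 2 (fun y => ψ y m) + WithLp.toLp 2 fun y => φ y m := rfl
    simp only [h, map_add]
    rfl
  map_smul' c ψ := by
    ext x m
    have h : (WithLp.toLp 2 fun y => (c • ψ) y m : Composite H (Bits N)) =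
        c • WithLp.toLp 2 (fun y => ψ y m) := rfl
    simp only [h, map_smul]
    rfl
  left_inv ψ := by
    ext x m
    change U.symm (U (WithLp.toLp 2 fun y => ψ y m)) x = ψ x m
    simp
  right_inv ψ := by
    ext x m
    change U (U.symm (WithLp.toLp 2 fun y => ψ y m)) x = ψ x m
    simp
  norm_map' ψ := by
    rw [← sq_eq_sq₀ (norm_nonneg _) (norm_nonneg _), norm_sq_composite₂, norm_sq_composite₂,
      Finset.sum_comm, Finset.sum_comm (f := fun x m => ‖ψ x m‖ ^ 2)]
    refine Finset.sum_congr rfl fun m _ => ?_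
    have h := congrArg (fun a => a ^ 2) (U.norm_map (WithLp.toLp 2 fun y => ψ y m))
    simp only [PiLp.norm_sq_eq_of_L2] at h
    exact h

namespace Attack

variable {N : ℕ} {H : Type*} [NormedAddCommGroup H] [InnerProductSpace ℂ H]

/-- The symmetrized attack `S† (U ⊗ I_M) S`, whose probe space is `H ⊗ M`, with `M` initially in
the state `2^{-N/2} ∑ m, |m⟩`. -/
def sym (A : Attack N H) : Attack N (Composite H (Bits N)) where
  probe := tensorVec A.probe (WithLp.toLp 2 fun _ => ((Real.sqrt (2 ^ N))⁻¹ : ℂ))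
  norm_probe := by
    rw [← sq_eq_sq₀ (norm_nonneg _) zero_le_one, PiLp.norm_sq_eq_of_L2]
    simp [tensorVec, norm_smul, A.norm_probe, Fintype.card_pi, ZMod.card]
  unitary := (symmetrizer N H).trans ((extendByRegister A.unitary).trans (symmetrizer N H).symm)

/-- The non-normalized probe state `|E'_{i,j}⟩_b`, defined by
`U |0⟩_E |i⟩_b = ∑ j, |E'_{i,j}⟩_b |j⟩_b`. -/
def probeState (A : Attack N H) (b i j : Bits N) : H :=
  partialInner (ket b j) (A.unitary (tensorVec A.probe (ket b i)))

/-- `Pr(j | i)` when the basis string `b` is used: the probability that Bob measures `j` given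
that Alice sent `i`. -/
def measureProb (A : Attack N H) (b i j : Bits N) : ℝ := ‖A.probeState b i j‖ ^ 2

variable {n : ℕ} (A : Attack N H) (b : Bits N) (s : InfoString N n) (iT jT : Bits (N - n))

/-- `Pr(j_T | i_I, i_T, b, s)`. -/
def testProb (iI : Bits n) : ℝ := ∑ jI, A.measureProb b (s.merge iI iT) (s.merge jI jT)

/-- `|E_{i_I, j_I}⟩_{b,s}`, which also depends on `i_T` and `j_T`. -/
def condProbeState (iI jI : Bits n) : H :=
  ((Real.sqrt (A.testProb b s iT jT iI) : ℂ))⁻¹ • A.probeState b (s.merge iI iT) (s.merge jI jT)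

/-- Eve's state `(ρ^{i_I})_E = ∑ j_I, |E_{i_I, j_I}⟩⟨E_{i_I, j_I}|` after her attack, given that
Alice sent the INFO bits `i_I`, and given `i_T, j_T, b, s`. -/
def eveState (iI : Bits n) : H →L[ℂ] H :=
  ∑ jI, InnerProductSpace.rankOne ℂ (A.condProbeState b s iT jT iI jI)
    (A.condProbeState b s iT jT iI jI)

end Attack

/-! ### Classical data of the protocol -/

/-- The pairs `(P_C, P_K)` of an `r × n` and an `m × n` matrix over `𝔽₂` all of whose `r + m`
rows put together are linearly independent. -/
abbrev KeyMatrices (n r m : ℕ) : Type :=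
  {P : Matrix (Fin r) (Fin n) (ZMod 2) × Matrix (Fin m) (Fin n) (ZMod 2) //
    LinearIndependent (ZMod 2) (Sum.elim (fun a => P.1 a) (fun a => P.2 a))}

instance (n r m : ℕ) : Fintype (KeyMatrices n r m) := Fintype.ofFinite _

/-- The uniform probability `Pr(P_C, P_K)`. -/
def keyMatricesProb (n r m : ℕ) : ℝ := (Fintype.card (KeyMatrices n r m) : ℝ)⁻¹

/-- The outcome of a run: the bits `i`, the basis string `b`, the string `s` and the matrices
`P = (P_C, P_K)` chosen by Alice, and the bits `j` measured by Bob. -/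
structure Outcome (N n r m : ℕ) where
  i : Bits N
  b : Bits N
  s : InfoString N n
  P : KeyMatrices n r m
  j : Bits N

/-- The basis string that Alice and Bob use when Alice chooses `b` and `s`: either `b` (the real
protocol), or `b⁰ = b ⊕ s` (the hypothetical "inverted-INFO-basis" protocol). -/
inductive Version
  | real
  | invertedInfoBasis

/-- See `Version`. -/
def Version.usedBasis {N n : ℕ} : Version → Bits N → InfoString N n → Bits N
  | .real, b, _ => b
  | .invertedInfoBasis, b, s => b + s.1

section Law

variable {N n : ℕ} {H : Type*} [NormedAddCommGroup H] [InnerProductSpace ℂ H]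

/-- The probability of an outcome when Eve applies the attack `A`: `i` is uniform,
`(b, s)` is drawn from `law`, `P` is uniform, these three are independent, and `j` is the result
of measuring in the basis that is used. -/
def outcomeProb (v : Version) (r m : ℕ) (law : PMF (Bits N × InfoString N n)) (A : Attack N H)
    (ω : Outcome N n r m) : ℝ :=
  (1 / 2 ^ N) * (law (ω.b, ω.s)).toReal * keyMatricesProb n r m *
    A.measureProb (v.usedBasis ω.b ω.s) ω.i ω.j

open Classical in
/-- The probability of an event. -/
def prob (v : Version) (r m : ℕ) (law : PMF (Bits N × InfoString N n)) (A : Attack N H)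
    (F : Set (Outcome N n r m)) : ℝ :=
  ∑ i : Bits N, ∑ b : Bits N, ∑ s : InfoString N n, ∑ P : KeyMatrices n r m, ∑ j : Bits N,
    if (⟨i, b, s, P, j⟩ : Outcome N n r m) ∈ F then outcomeProb v r m law A ⟨i, b, s, P, j⟩ else 0

/-- The conditional probability of the event `F` given the event `G`. -/
def condProb (v : Version) (r m : ℕ) (law : PMF (Bits N × InfoString N n)) (A : Attack N H)
    (F G : Set (Outcome N n r m)) : ℝ :=
  prob v r m law A (F ∩ G) / prob v r m law A G

end Law

/-- The event that the TEST bits of Alice and Bob and the chosen strings `b, s` have the given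
values. -/
def publicEvent {N n : ℕ} (r m : ℕ) (iT jT : Bits (N - n)) (b : Bits N) (s : InfoString N n) :
    Set (Outcome N n r m) :=
  {ω | ω.s.test ω.i = iT ∧ ω.s.test ω.j = jT ∧ ω.b = b ∧ ω.s = s}

/-- The event `|C_I| ≥ t`, where `C_I = i_I ⊕ j_I`. -/
def infoErrorEvent (N n r m t : ℕ) : Set (Outcome N n r m) :=
  {ω | t ≤ hammingNorm (ω.s.info ω.i + ω.s.info ω.j)}

/-- `ρ̂_k`, the state of Eve (including the register that holds `P_C, P_K`) corresponding to the
final key `k`, given the syndrome `ξ` and `i_T, j_T, b, s`. -/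
def keyState {N n r m : ℕ} {H : Type*} [NormedAddCommGroup H] [InnerProductSpace ℂ H]
    (A : Attack N H) (b : Bits N) (s : InfoString N n) (iT jT : Bits (N - n)) (ξ : Bits r)
    (k : Bits m) : Composite H (KeyMatrices n r m) →L[ℂ] Composite H (KeyMatrices n r m) :=
  (((2 : ℝ) ^ (n - r - m))⁻¹ : ℂ) • ∑ P : KeyMatrices n r m,
    ∑ iI : Bits n with iI ᵥ* P.1.1ᵀ = ξ ∧ iI ᵥ* P.1.2ᵀ = k,
      (keyMatricesProb n r m : ℂ) • tensorProj (A.eveState b s iT jT iI) P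

/-- The binary entropy `H₂(x) = -x log₂ x - (1 - x) log₂ (1 - x)`. -/
def H₂ (x : ℝ) : ℝ := -x * Real.logb 2 x - (1 - x) * Real.logb 2 (1 - x)

end BB84

end

noncomputable section

namespace BB84

/-! ### Fourier analysis on bit strings -/

/-! Fix the TEST bits, `b` and `s`, and let `e c x` be Eve's normalized state when the INFO bits are
`x` and the INFO error string is `c`, so that her mixed state is `∑ c, |e c x⟩⟨e c x|`. Passing from
`b` to `b ⊕ s` is a Hadamard transform of the INFO bits of both Alice and Bob. By Parseval, the
error string of the inverted protocol then has the law `w(l) = ∑ c, ‖fourier (e c) l‖²`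
(`Attack.sum_measureProb_add_merge`, `Attack.exists_normalized_states`). Symmetrization makes
translations of `x` act on each `e c` by isometries (`Attack.sym_probeState_translate`); hence the
normalization does not depend on `x`, and each spectral part of `e c` has the same norm at every
`x`.

Now fix the matrices `P` and average over the `x` with a given syndrome and key. If every `e c` is
cut down to a set `G` of frequencies, no two of which differ by an element of the row span, the
cross terms cancel and the average no longer depends on the key (`sum_rankOne_fourierPart`). The cut
costs at most `2 √w(Gᶜ)` per state (`nuclearBound_sub_fourierPart`, converted to the trace norm by
`traceNorm_le`), so the states of two keys differ by at most the mean of `4 √w(Gᶜ)` over `P`. All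
key bits are handled at once, and the factor `m` of the bound enters only through `1 ≤ m`.

Take `G = P.leaders t`. A string of law `w` falls outside `G` only if its weight is at least `t`, or
if its coset contains another string of weight less than `t`. There are at most `2^{n H₂(t/n)}` such
strings (`card_hammingNorm_lt_le`), and each lies in the coset with probability at most `2^{r+m-n}`
(`KeyMatrices.prob_mem_rowSpan_le`). Cauchy–Schwarz moves the mean over `P` under the square root.
-/

theorem sgn_comm {n : ℕ} (x y : Bits n) : sgn x y = sgn y x := by
  rw [sgn, sgn, dotProduct_comm]

theorem sgn_add_left {n : ℕ} (x y z : Bits n) : sgn (x + y) z = sgn x z * sgn y z := by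
  rw [sgn, add_dotProduct, neg_one_pow_val_add, sgn, sgn]

theorem sgn_add_right {n : ℕ} (x y z : Bits n) : sgn x (y + z) = sgn x y * sgn x z := by
  rw [sgn_comm, sgn_add_left, sgn_comm y, sgn_comm z]

theorem sgn_zero_right {n : ℕ} (x : Bits n) : sgn x 0 = 1 := by simp [sgn]

theorem conj_sgn {n : ℕ} (x y : Bits n) : (starRingEnd ℂ) (sgn x y) = sgn x y := by
  simp [sgn]

theorem sgn_eq_neg_one {n : ℕ} {x y : Bits n} (h : x ⬝ᵥ y ≠ 0) : sgn x y = -1 := by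
  have h1 : x ⬝ᵥ y = 1 := (bit_cases _).resolve_left h
  rw [sgn, h1]
  simp [show (1 : ZMod 2).val = 1 from rfl]

theorem add_eq_zero_iff_eq_bits {n : ℕ} {x y : Bits n} : x + y = 0 ↔ x = y := by
  constructor
  · intro h
    calc x = x + (x + y) := by rw [h, add_zero]
      _ = y := by rw [← add_assoc, bits_add_self, zero_add]
  · rintro rfl
    exact bits_add_self x

theorem card_bits (n : ℕ) : Fintype.card (Bits n) = 2 ^ n := by
  simp [Fintype.card_pi, ZMod.card]

/-- A sum of signs over a set that is invariant under translation by `d`, with `d · y ≠ 0`,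
vanishes. -/
theorem sum_sgn_eq_zero {n : ℕ} (F : Finset (Bits n)) (d y : Bits n)
    (hF : ∀ x ∈ F, x + d ∈ F) (hd : d ⬝ᵥ y ≠ 0) : ∑ x ∈ F, sgn x y = 0 := by
  refine Finset.sum_involution (fun x _ => x + d) ?_ ?_ ?_ ?_
  · intro x _
    rw [sgn_add_left, sgn_eq_neg_one hd]
    ring
  · intro x _ _ h
    refine hd ?_
    rw [add_eq_left.1 h, zero_dotProduct]
  · exact fun x hx => hF x hx
  · intro x _
    rw [add_assoc, bits_add_self, add_zero]

theorem sum_sgn {n : ℕ} (y : Bits n) :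
    ∑ x : Bits n, sgn x y = if y = 0 then (2 : ℂ) ^ n else 0 := by
  split_ifs with h
  · simp [h, sgn_zero_right, ZMod.card]
  · obtain ⟨p, hp⟩ := Function.ne_iff.1 h
    refine sum_sgn_eq_zero _ (Pi.single p 1) y (fun _ _ => Finset.mem_univ _) ?_
    simpa using hp

section Fourier

variable {n : ℕ} {K : Type*} [NormedAddCommGroup K] [InnerProductSpace ℂ K]

theorem inner_self_eq_norm_sq_complex (v : K) : ⟪v, v⟫_ℂ = (‖v‖ : ℂ) ^ 2 :=
  inner_self_eq_norm_sq_to_K v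

/-- Parseval for vector-valued functions: after expanding the square, orthogonality of characters
(`sum_sgn`) leaves only the diagonal terms. -/
theorem sum_norm_sq_sum_sgn (g : Bits n → K) :
    ∑ x : Bits n, ‖∑ l, sgn x l • g l‖ ^ 2 = 2 ^ n * ∑ l, ‖g l‖ ^ 2 := by
  have key : ((∑ x : Bits n, ‖∑ l, sgn x l • g l‖ ^ 2 : ℝ) : ℂ) =
      ((2 ^ n * ∑ l, ‖g l‖ ^ 2 : ℝ) : ℂ) := by
    push_cast
    have h : ∀ x : Bits n, ((‖∑ l, sgn x l • g l‖ : ℂ)) ^ 2 =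
        ∑ l, ∑ l', sgn x (l + l') * ⟪g l, g l'⟫_ℂ := by
      intro x
      rw [← inner_self_eq_norm_sq_complex, sum_inner]
      refine Finset.sum_congr rfl fun l _ => ?_
      rw [inner_sum]
      refine Finset.sum_congr rfl fun l' _ => ?_
      rw [inner_smul_left, inner_smul_right, conj_sgn, sgn_add_right, mul_assoc]
    simp only [h]
    rw [Finset.sum_comm, Finset.mul_sum]
    refine Finset.sum_congr rfl fun l _ => ?_
    rw [Finset.sum_comm]
    simp only [← Finset.sum_mul, sum_sgn, add_eq_zero_iff_eq_bits]
    simp only [ite_mul, zero_mul, Finset.sum_ite_eq, Finset.mem_univ, if_true,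
      inner_self_eq_norm_sq_complex]
  exact_mod_cast key

/-- The Fourier transform of a function on bit strings. -/
def fourier (f : Bits n → K) (l : Bits n) : K := ((2 : ℂ) ^ n)⁻¹ • ∑ x, sgn x l • f x

theorem sum_sgn_smul_fourier (f : Bits n → K) (x : Bits n) :
    ∑ l, sgn x l • fourier f l = f x := by
  simp only [fourier, smul_comm _ ((2 : ℂ) ^ n)⁻¹, ← Finset.smul_sum]
  simp only [Finset.smul_sum (s := (Finset.univ : Finset (Bits n))), smul_smul (sgn _ _)]
  rw [Finset.sum_comm]
  simp only [← sgn_add_left, ← Finset.sum_smul, sgn_comm _, ← Finset.smul_sum]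
  simp [sum_sgn, add_eq_zero_iff_eq_bits, smul_smul]

theorem sum_norm_sq_fourier (f : Bits n → K) :
    2 ^ n * ∑ l, ‖fourier f l‖ ^ 2 = ∑ x, ‖f x‖ ^ 2 := by
  rw [← sum_norm_sq_sum_sgn]
  simp only [sum_sgn_smul_fourier]

/-- The part of `f` whose Fourier transform is supported on `G`. -/
def fourierPart (G : Finset (Bits n)) (f : Bits n → K) (x : Bits n) : K :=
  ∑ l ∈ G, sgn x l • fourier f l

theorem sub_fourierPart (G : Finset (Bits n)) (f : Bits n → K) (x : Bits n) :
    f x - fourierPart G f x = fourierPart Gᶜ f x := by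
  rw [sub_eq_iff_eq_add', fourierPart, fourierPart, Finset.sum_add_sum_compl,
    sum_sgn_smul_fourier]

theorem sum_norm_sq_fourierPart (G : Finset (Bits n)) (f : Bits n → K) :
    ∑ x, ‖fourierPart G f x‖ ^ 2 = 2 ^ n * ∑ l ∈ G, ‖fourier f l‖ ^ 2 := by
  have h : ∀ x, fourierPart G f x = ∑ l, sgn x l • if l ∈ G then fourier f l else 0 := by
    intro x
    simp [fourierPart, Finset.sum_ite_mem]
  simp only [h, sum_norm_sq_sum_sgn]
  congr 1
  rw [← Finset.sum_filter_add_sum_filter_not Finset.univ (· ∈ G)]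
  rw [Finset.sum_congr rfl (g := fun l => ‖fourier f l‖ ^ 2),
    Finset.sum_eq_zero (s := Finset.univ.filter (· ∉ G))]
  · simp
  · intro l hl
    simp [(Finset.mem_filter.1 hl).2]
  · intro l hl
    simp [(Finset.mem_filter.1 hl).2]

/-- If translations act on `f` by isometries, then the norm of each of its spectral parts is
constant. -/
theorem norm_fourierPart_eq (G : Finset (Bits n)) (f : Bits n → K)
    (hf : ∀ a, ∃ τ : K →ₗᵢ[ℂ] K, ∀ x, f (x + a) = τ (f x)) (x y : Bits n) :
    ‖fourierPart G f x‖ = ‖fourierPart G f y‖ := by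
  -- In characteristic 2, translation by `y + x` takes `y` to `x`.
  obtain ⟨τ, hτ⟩ := hf (y + x)
  have h : fourierPart G f x = τ (fourierPart G f y) := by
    simp only [fourierPart, fourier, map_sum, map_smul]
    refine Finset.sum_congr rfl fun l _ => ?_
    simp only [smul_comm _ ((2 : ℂ) ^ n)⁻¹]
    congr 1
    rw [Finset.smul_sum, Finset.smul_sum, ← Equiv.sum_comp (Equiv.addRight (y + x))]
    refine Finset.sum_congr rfl fun z _ => ?_
    rw [Equiv.coe_addRight, hτ, smul_smul, smul_smul, ← sgn_add_left, ← sgn_add_left]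
    congr 2
    have := bits_add_self x
    calc x + (z + (y + x)) = y + z + (x + x) := by abel
      _ = y + z := by rw [this, add_zero]
  rw [h, τ.norm_map]

/-- Plancherel gives the sum over `x`, and its `2 ^ n` terms are equal because translations act by
isometries. This turns an average statement into a pointwise one. -/
theorem norm_sq_fourierPart (G : Finset (Bits n)) (f : Bits n → K)
    (hf : ∀ a, ∃ τ : K →ₗᵢ[ℂ] K, ∀ x, f (x + a) = τ (f x)) (x : Bits n) :
    ‖fourierPart G f x‖ ^ 2 = ∑ l ∈ G, ‖fourier f l‖ ^ 2 := by
  have h := sum_norm_sq_fourierPart G f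
  simp only [norm_fourierPart_eq G f hf _ x, Finset.sum_const, Finset.card_univ, card_bits,
    nsmul_eq_mul, Nat.cast_pow, Nat.cast_ofNat] at h
  exact mul_left_cancel₀ (by positivity) h

end Fourier

/-! ### Trace norm -/

section TraceNorm

variable {K : Type*} [NormedAddCommGroup K] [InnerProductSpace ℂ K]

/-- By Bessel's inequality, the trace of a sum of operators `|x⟩⟨y|` over a part of an orthonormal
family is at most the sum of the `‖x‖ ‖y‖`. -/
theorem sum_re_inner_le {ι α : Type*} [Fintype α] {e : ι → K} (he : Orthonormal ℂ e)
    (F : Finset ι) (x y : α → K) :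
    ∑ i ∈ F, RCLike.re ⟪e i, ∑ a, ⟪y a, e i⟫_ℂ • x a⟫_ℂ ≤ ∑ a, ‖x a‖ * ‖y a‖ := by
  have h1 : ∀ z : K, √(∑ i ∈ F, ‖⟪e i, z⟫_ℂ‖ ^ 2) ≤ ‖z‖ := fun z =>
    (Real.sqrt_le_left (norm_nonneg z)).2 (he.sum_inner_products_le z)
  calc ∑ i ∈ F, RCLike.re ⟪e i, ∑ a, ⟪y a, e i⟫_ℂ • x a⟫_ℂ
      ≤ ∑ i ∈ F, ∑ a, ‖⟪e i, x a⟫_ℂ‖ * ‖⟪e i, y a⟫_ℂ‖ := by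
        refine Finset.sum_le_sum fun i _ => ?_
        refine (RCLike.re_le_norm _).trans ?_
        rw [inner_sum]
        refine (norm_sum_le _ _).trans (Finset.sum_le_sum fun a _ => ?_)
        rw [inner_smul_right, norm_mul, norm_inner_symm, mul_comm]
    _ = ∑ a, ∑ i ∈ F, ‖⟪e i, x a⟫_ℂ‖ * ‖⟪e i, y a⟫_ℂ‖ := Finset.sum_comm
    _ ≤ ∑ a, ‖x a‖ * ‖y a‖ := by
        refine Finset.sum_le_sum fun a _ => ?_
        refine (Real.sum_mul_le_sqrt_mul_sqrt _ _ _).trans ?_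
        exact mul_le_mul (h1 _) (h1 _) (Real.sqrt_nonneg _) (norm_nonneg _)

variable [CompleteSpace K]

/-- A contraction `W` with `|T| ≤ W T + ε`. -/
theorem exists_contraction_abs_le (T : K →L[ℂ] K) (hT : IsSelfAdjoint T) {ε : ℝ} (hε : 0 < ε) :
    ∃ W : K →L[ℂ] K, ‖W‖ ≤ 1 ∧
      ∀ v : K, RCLike.re ⟪v, CFC.abs T v⟫_ℂ ≤ RCLike.re ⟪v, W (T v)⟫_ℂ + ε * ‖v‖ ^ 2 := by
  have hpos : ∀ x : ℝ, 0 < |x| + ε := fun x => by positivity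
  have hc : Continuous fun x : ℝ => x / (|x| + ε) :=
    continuous_id.div (by fun_prop) fun x => (hpos x).ne'
  -- A continuous substitute for the sign function, which makes `W` available through the continuous
  -- functional calculus; `|x| ≤ x² / (|x| + ε) + ε`.
  refine ⟨cfc (fun x : ℝ => x / (|x| + ε)) T, ?_, fun v => ?_⟩
  · refine norm_cfc_le zero_le_one fun x _ => ?_
    rw [Real.norm_eq_abs, abs_div, abs_of_pos (hpos x), div_le_one (hpos x)]
    linarith
  · have h1 : cfc (fun x : ℝ => x / (|x| + ε)) T * T = cfc (fun x : ℝ => x / (|x| + ε) * x) T := by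
      rw [cfc_mul (fun x : ℝ => x / (|x| + ε)) (fun x => x) T hc.continuousOn continuousOn_id,
        cfc_id' ℝ T]
    have h2 : CFC.abs T ≤ cfc (fun x : ℝ => x / (|x| + ε)) T * T + ε • 1 := by
      have h0 : cfc (fun x : ℝ => x / (|x| + ε) * x + ε) T =
          cfc (fun x : ℝ => x / (|x| + ε) * x) T + ε • 1 := by
        rw [cfc_add (a := T) (fun x : ℝ => x / (|x| + ε) * x) (fun _ => ε)
          (hc.mul continuous_id).continuousOn continuousOn_const, cfc_const ε T,
          Algebra.algebraMap_eq_smul_one]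
      rw [h1, ← h0, CFC.abs_eq_cfc_norm T]
      refine cfc_mono (fun x _ => ?_) continuous_norm.continuousOn
        ((hc.mul continuous_id).add continuous_const).continuousOn
      have h5 := hpos x
      rw [Real.norm_eq_abs, div_mul_eq_mul_div, div_add' _ _ _ h5.ne', le_div_iff₀ h5,
        ← abs_mul_abs_self x]
      nlinarith [abs_nonneg x]
    have h3 := (ContinuousLinearMap.le_def _ _).1 h2
    have h4 := h3.re_inner_nonneg_right v
    rw [sub_apply, add_apply, inner_sub_right, inner_add_right, map_sub, map_add, smul_apply,
      one_apply_eq_self, inner_smul_right_eq_smul, RCLike.smul_re,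
      inner_self_eq_norm_sq] at h4
    exact sub_nonneg.1 h4

/-- A contraction `W` with `|T|` nearly below `W T` can be absorbed into the vectors `x a` without
increasing their norms. The trace over finitely many basis vectors is then bounded by Bessel's
inequality, and the full trace is the supremum of these. -/
theorem traceNorm_le {α : Type*} [Fintype α] (T : K →L[ℂ] K) (hT : IsSelfAdjoint T) (x y : α → K)
    (h : T = ∑ a, InnerProductSpace.rankOne ℂ (x a) (y a)) :
    traceNorm T ≤ ENNReal.ofReal (∑ a, ‖x a‖ * ‖y a‖) := by
  have hp : ∀ v : K, 0 ≤ RCLike.re ⟪v, CFC.abs T v⟫_ℂ := fun v =>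
    (ContinuousLinearMap.nonneg_iff_isPositive _ |>.1 (CFC.abs_nonneg T)).re_inner_nonneg_right v
  set B := (exists_hilbertBasis ℂ K).choose
  have hB : Orthonormal ℂ ((↑) : B → K) := by
    obtain ⟨b, hb⟩ := (exists_hilbertBasis ℂ K).choose_spec
    rw [← hb]
    exact b.orthonormal
  rw [traceNorm, ENNReal.tsum_eq_iSup_sum]
  refine iSup_le fun F => ?_
  rw [← ENNReal.ofReal_sum_of_nonneg fun _ _ => hp _]
  refine ENNReal.ofReal_le_ofReal (le_of_forall_pos_le_add fun δ hδ => ?_)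
  -- The error `ε` is incurred once per vector of `F`, so the total stays below `δ`.
  have hε : 0 < δ / (F.card + 1) := by positivity
  obtain ⟨W, hW, hWT⟩ := exists_contraction_abs_le T hT hε
  calc ∑ e ∈ F, RCLike.re ⟪(e : K), CFC.abs T e⟫_ℂ
      ≤ ∑ e ∈ F, (RCLike.re ⟪(e : K), ∑ a, ⟪y a, (e : K)⟫_ℂ • W (x a)⟫_ℂ + δ / (F.card + 1)) := by
        refine Finset.sum_le_sum fun e _ => (hWT e).trans (le_of_eq ?_)
        rw [h]
        simp [hB.norm_eq_one e, map_sum]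
    _ ≤ ∑ a, ‖W (x a)‖ * ‖y a‖ + δ := by
        rw [Finset.sum_add_distrib]
        refine add_le_add (sum_re_inner_le hB F _ _) ?_
        rw [Finset.sum_const, nsmul_eq_mul, mul_div_assoc', div_le_iff₀ (by positivity)]
        nlinarith
    _ ≤ ∑ a, ‖x a‖ * ‖y a‖ + δ := by
        gcongr with a
        exact (W.le_of_opNorm_le hW _).trans_eq (one_mul _)

theorem traceNorm_zero : traceNorm (0 : K →L[ℂ] K) = 0 := by simp [traceNorm]

theorem isSelfAdjoint_sub_operator {T T' : K →L[ℂ] K} (h : IsSelfAdjoint T)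
    (h' : IsSelfAdjoint T') : IsSelfAdjoint (T - T') := h.sub h'

theorem isSelfAdjoint_sum_operator {α : Type*} (F : Finset α) {T : α → K →L[ℂ] K}
    (h : ∀ a ∈ F, IsSelfAdjoint (T a)) : IsSelfAdjoint (∑ a ∈ F, T a) := isSelfAdjoint_sum F h

end TraceNorm

/-! ### Random linear codes -/

/-- The rows of `P_C` and `P_K`. -/
def KeyMatrices.rows {n r m : ℕ} (P : KeyMatrices n r m) :
    Matrix (Fin r ⊕ Fin m) (Fin n) (ZMod 2) :=
  Sum.elim (fun a => P.1.1 a) (fun a => P.1.2 a)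

theorem KeyMatrices.linearIndependent_rows {n r m : ℕ} (P : KeyMatrices n r m) :
    LinearIndependent (ZMod 2) P.rows.row := P.2

/-- The span of the rows of `P_C` and `P_K`. -/
def KeyMatrices.rowSpan {n r m : ℕ} (P : KeyMatrices n r m) : Submodule (ZMod 2) (Bits n) :=
  Submodule.span (ZMod 2) (Set.range P.rows.row)

/-- The strings with syndrome `ξ` and key `k`. -/
def KeyMatrices.fiber {n r m : ℕ} (P : KeyMatrices n r m) (ξ : Bits r) (k : Bits m) :
    Finset (Bits n) :=
  Finset.univ.filter fun x => x ᵥ* P.1.1ᵀ = ξ ∧ x ᵥ* P.1.2ᵀ = k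

theorem KeyMatrices.mem_fiber {n r m : ℕ} {P : KeyMatrices n r m} {ξ : Bits r} {k : Bits m}
    {x : Bits n} : x ∈ P.fiber ξ k ↔ P.rows *ᵥ x = Sum.elim ξ k := by
  rw [fiber, Finset.mem_filter, Matrix.vecMul_transpose, Matrix.vecMul_transpose]
  simp only [Finset.mem_univ, true_and, funext_iff, Sum.forall]
  rfl

theorem KeyMatrices.mulVec_surjective {n r m : ℕ} (P : KeyMatrices n r m) :
    Function.Surjective P.rows.mulVecLin := by
  rw [← LinearMap.range_eq_top]
  refine Submodule.eq_top_of_finrank_eq ?_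
  have h : P.rows.rank = _ := P.linearIndependent_rows.rank_matrix
  rw [Matrix.rank] at h
  rw [h, Module.finrank_fintype_fun_eq_card]

/-- All fibers of a surjective linear map are translates of each other, so the `2 ^ n` strings are
shared equally among `2 ^ (r + m)` fibers. -/
theorem KeyMatrices.card_fiber {n r m : ℕ} (P : KeyMatrices n r m) (ξ : Bits r) (k : Bits m) :
    (P.fiber ξ k).card = 2 ^ (n - r - m) := by
  classical
  have h1 : ∀ y, (Finset.univ.filter fun x => P.rows.mulVecLin x = y).card = (P.fiber ξ k).card := by
    intro y
    have h2 : P.fiber ξ k = Finset.univ.filter fun x => P.rows.mulVecLin x = Sum.elim ξ k := by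
      ext x
      rw [mem_fiber, Finset.mem_filter, Matrix.mulVecLin_apply]
      exact (and_iff_right (Finset.mem_univ _)).symm
    rw [h2]
    obtain ⟨u, hu⟩ := P.mulVec_surjective (Sum.elim ξ k - y)
    refine Finset.card_bij' (fun x _ => x + u) (fun x _ => x - u) ?_ ?_ ?_ ?_
    · intro x hx
      simp only [Finset.mem_filter, Finset.mem_univ, true_and] at hx ⊢
      rw [map_add, hx, hu, add_sub_cancel]
    · intro x hx
      simp only [Finset.mem_filter, Finset.mem_univ, true_and] at hx ⊢
      rw [map_sub, hx, hu, sub_sub_cancel]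
    · simp
    · simp
  have h3 := Finset.card_eq_sum_card_fiberwise (f := P.rows.mulVecLin) (s := Finset.univ)
    (t := Finset.univ) (fun _ _ => Finset.mem_univ _)
  simp only [h1, Finset.sum_const, Finset.card_univ, card_bits, smul_eq_mul] at h3
  rw [Fintype.card_fun, ZMod.card, Fintype.card_sum, Fintype.card_fin, Fintype.card_fin] at h3
  -- Independence of the rows makes the truncated subtraction `n - r - m` exact.
  have h4 : r + m ≤ n := by
    have := P.linearIndependent_rows.fintype_card_le_finrank
    simpa using this
  have h5 : (2 : ℕ) ^ n = 2 ^ (r + m) * 2 ^ (n - r - m) := by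
    rw [← pow_add]
    congr 1
    omega
  rw [h5] at h3
  exact (Nat.eq_of_mul_eq_mul_left (by positivity) h3).symm

/-- Some linear functional vanishes on the row span but not at `y`. Written as the dot product with
a string `d`, it shows that translation by `d` preserves the fiber and flips the sign of every term.
-/
theorem KeyMatrices.sum_sgn_fiber {n r m : ℕ} (P : KeyMatrices n r m) (ξ : Bits r) (k : Bits m)
    {y : Bits n} (hy : y ∉ P.rowSpan) : ∑ x ∈ P.fiber ξ k, sgn x y = 0 := by
  obtain ⟨f, hf, hle⟩ := Submodule.exists_le_ker_of_notMem hy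
  have hdot : ∀ v : Bits n, (fun p => f (Pi.single p 1)) ⬝ᵥ v = f v := by
    intro v
    conv_rhs => rw [LinearMap.pi_apply_eq_sum_univ f v]
    refine Finset.sum_congr rfl fun p _ => ?_
    rw [mul_comm, smul_eq_mul]
    refine congrArg (v p * ·) (congrArg f (funext fun q => ?_))
    simp [Pi.single_apply, eq_comm]
  refine sum_sgn_eq_zero _ (fun p => f (Pi.single p 1)) y ?_ (by rwa [hdot])
  intro x hx
  rw [mem_fiber] at hx ⊢
  rw [Matrix.mulVec_add, hx]
  refine add_eq_left.2 (funext fun a => ?_)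
  rw [Matrix.mulVec, dotProduct_comm, hdot]
  exact hle (Submodule.subset_span ⟨a, rfl⟩)

/-- The isomorphism between the lines through `x` and `y` extends to the whole space. Transitivity
on nonzero vectors is what makes combinations of random rows uniform. -/
theorem exists_linearEquiv_apply_eq {k V : Type*} [Field k] [AddCommGroup V] [Module k V]
    [FiniteDimensional k V] {x y : V} (hx : x ≠ 0) (hy : y ≠ 0) : ∃ g : V ≃ₗ[k] V, g x = y := by
  obtain ⟨g, hg⟩ := Submodule.exists_linearEquiv_restrict_eq
    ((LinearEquiv.toSpanNonzeroSingleton k V x hx).symm ≪≫ₗ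
      LinearEquiv.toSpanNonzeroSingleton k V y hy)
  have h := hg (LinearEquiv.toSpanNonzeroSingleton k V x hx 1)
  rw [LinearEquiv.trans_apply, LinearEquiv.symm_apply_apply] at h
  exact ⟨g, by simpa using h.symm⟩

/-- The pair of matrices whose rows are transformed by `g`. -/
def KeyMatrices.map {n r m : ℕ} (g : Bits n ≃ₗ[ZMod 2] Bits n) (P : KeyMatrices n r m) :
    KeyMatrices n r m :=
  ⟨(fun a => g (P.1.1 a), fun a => g (P.1.2 a)), by
    have h : LinearIndependent (ZMod 2) (⇑g ∘ P.rows.row) := P.2.map' g.toLinearMap g.ker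
    have e : (Sum.elim (fun a => g (P.1.1 a)) fun a => g (P.1.2 a)) = ⇑g ∘ P.rows.row := by
      funext a
      cases a <;> rfl
    rwa [← e] at h⟩

theorem KeyMatrices.rows_map {n r m : ℕ} (g : Bits n ≃ₗ[ZMod 2] Bits n) (P : KeyMatrices n r m)
    (a : Fin r ⊕ Fin m) : (P.map g).rows a = g (P.rows a) := by
  cases a <;> rfl

open Classical in
-- Applying to all rows an automorphism that takes `x` to `y` is injective on pairs of matrices. By
-- symmetry, a fixed combination of rows takes all nonzero values equally often.
theorem KeyMatrices.card_vecMul_le {n r m : ℕ} (a : Fin r ⊕ Fin m → ZMod 2) {x y : Bits n}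
    (hx : x ≠ 0) (hy : y ≠ 0) :
    (Finset.univ.filter fun P : KeyMatrices n r m => ∑ i, a i • P.rows i = x).card ≤
      (Finset.univ.filter fun P : KeyMatrices n r m => ∑ i, a i • P.rows i = y).card := by
  obtain ⟨g, rfl⟩ := exists_linearEquiv_apply_eq (k := ZMod 2) hx hy
  refine Finset.card_le_card_of_injOn (KeyMatrices.map g) ?_ ?_
  · intro P hP
    simp only [Finset.coe_filter, Finset.mem_univ, true_and, Set.mem_ofPred_eq] at hP ⊢
    rw [← hP, map_sum]
    simp only [rows_map, map_smul]
  · intro P _ Q _ h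
    have h1 : ∀ i, P.rows i = Q.rows i := by
      intro i
      apply g.injective
      rw [← rows_map, ← rows_map, h]
    exact Subtype.ext (Prod.ext (funext fun i => h1 (Sum.inl i)) (funext fun i => h1 (Sum.inr i)))

open Classical in
-- A nontrivial combination of independent rows never vanishes, so the pairs are distributed over
-- the `2 ^ n - 1` nonzero values, each taken at least as often as `x`.
theorem KeyMatrices.card_vecMul_mul_le {n r m : ℕ} {a : Fin r ⊕ Fin m → ZMod 2} (ha : a ≠ 0)
    {x : Bits n} (hx : x ≠ 0) :
    (Finset.univ.filter fun P : KeyMatrices n r m => ∑ i, a i • P.rows i = x).card * (2 ^ n - 1) ≤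
      Fintype.card (KeyMatrices n r m) := by
  have h1 : (Finset.univ.filter fun y : Bits n => y ≠ 0).card = 2 ^ n - 1 := by
    rw [Finset.filter_ne', Finset.card_erase_of_mem (Finset.mem_univ _), Finset.card_univ, card_bits]
  have h2 := Finset.card_eq_sum_card_fiberwise
    (f := fun P : KeyMatrices n r m => ∑ i, a i • P.rows i) (s := Finset.univ)
    (t := Finset.univ.filter fun y : Bits n => y ≠ 0) (by
      intro P _
      simp only [Finset.coe_filter, Finset.mem_univ, true_and, Set.mem_ofPred_eq]
      intro h
      exact ha (funext (Fintype.linearIndependent_iff.1 P.2 a h)))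
  rw [← Finset.card_univ, h2, mul_comm, ← h1, ← smul_eq_mul, ← Finset.sum_const]
  refine Finset.sum_le_sum fun y hy => ?_
  exact card_vecMul_le a hx (Finset.mem_filter.1 hy).2

open Classical in
-- A union bound over the `2 ^ (r + m) - 1` nonzero coefficient vectors.
theorem KeyMatrices.card_mem_rowSpan_mul_le {n r m : ℕ} {x : Bits n} (hx : x ≠ 0) :
    (Finset.univ.filter fun P : KeyMatrices n r m => x ∈ P.rowSpan).card * 2 ^ n ≤
      2 ^ (r + m) * Fintype.card (KeyMatrices n r m) := by
  set c := (Finset.univ.filter fun P : KeyMatrices n r m => x ∈ P.rowSpan).card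
  set q := Fintype.card (KeyMatrices n r m)
  have h1 : (Finset.univ.filter fun a : Fin r ⊕ Fin m → ZMod 2 => a ≠ 0).card =
      2 ^ (r + m) - 1 := by
    rw [Finset.filter_ne', Finset.card_erase_of_mem (Finset.mem_univ _), Finset.card_univ,
      Fintype.card_fun, ZMod.card, Fintype.card_sum, Fintype.card_fin, Fintype.card_fin]
  have h2 : c ≤ ∑ a : Fin r ⊕ Fin m → ZMod 2 with a ≠ 0,
      (Finset.univ.filter fun P : KeyMatrices n r m => ∑ i, a i • P.rows i = x).card := by
    refine (Finset.card_le_card ?_).trans Finset.card_biUnion_le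
    intro P hP
    rw [Finset.mem_filter] at hP
    obtain ⟨a, ha⟩ := (Submodule.mem_span_range_iff_exists_fun (ZMod 2)).1 hP.2
    simp only [Finset.mem_biUnion, Finset.mem_filter, Finset.mem_univ, true_and]
    refine ⟨a, ?_, ha⟩
    rintro rfl
    exact hx (by simpa using ha.symm)
  have h3 : c * (2 ^ n - 1) ≤ (2 ^ (r + m) - 1) * q := by
    refine (Nat.mul_le_mul_right _ h2).trans ?_
    rw [Finset.sum_mul, ← h1, ← smul_eq_mul, ← Finset.sum_const]
    exact Finset.sum_le_sum fun a ha => card_vecMul_mul_le (Finset.mem_filter.1 ha).2 hx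
  -- Adding `c ≤ q` to `h3` removes the `- 1` on both sides.
  have h4 : c ≤ q := Finset.card_le_univ _
  obtain ⟨u, hu⟩ := Nat.exists_eq_add_of_le' (Nat.one_le_two_pow (n := n))
  obtain ⟨v, hv⟩ := Nat.exists_eq_add_of_le' (Nat.one_le_two_pow (n := r + m))
  rw [hu, hv] at h3 ⊢
  simp only [Nat.add_sub_cancel] at h3
  nlinarith

open Classical in
/-- A nonzero string lies in the span of the rows of random matrices with probability at most
`2^{r+m-n}`. -/
theorem KeyMatrices.prob_mem_rowSpan_le {n r m : ℕ} {x : Bits n} (hx : x ≠ 0) :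
    ∑ P : KeyMatrices n r m, (if x ∈ P.rowSpan then keyMatricesProb n r m else 0) ≤
      (2 : ℝ) ^ (r + m) / 2 ^ n := by
  rw [← Finset.sum_filter, Finset.sum_const, nsmul_eq_mul, keyMatricesProb]
  rcases Nat.eq_zero_or_pos (Fintype.card (KeyMatrices n r m)) with h | h
  · rw [h]
    simp only [Nat.cast_zero, inv_zero, mul_zero]
    positivity
  · rw [← div_eq_mul_inv, div_le_div_iff₀ (by positivity) (by positivity)]
    exact_mod_cast KeyMatrices.card_mem_rowSpan_mul_le hx

/-- The inequality also covers an empty set of matrices, where the probability is `0⁻¹ = 0`. -/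
theorem sum_keyMatricesProb_le (n r m : ℕ) :
    ∑ _P : KeyMatrices n r m, keyMatricesProb n r m ≤ 1 := by
  rw [Finset.sum_const, nsmul_eq_mul, keyMatricesProb, Finset.card_univ]
  exact mul_inv_le_one

theorem keyMatricesProb_nonneg (n r m : ℕ) : 0 ≤ keyMatricesProb n r m := by
  rw [keyMatricesProb]
  positivity

/-! ### Entropy bound for Hamming balls -/

/-- The total mass of `n` independent bits, each equal to `1` with probability `p`. -/
theorem sum_pow_hammingNorm (n : ℕ) (p : ℝ) :
    ∑ x : Bits n, p ^ hammingNorm x * (1 - p) ^ (n - hammingNorm x) = 1 := by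
  have h : ∀ x : Bits n, p ^ hammingNorm x * (1 - p) ^ (n - hammingNorm x) =
      ∏ a, if x a ≠ 0 then p else 1 - p := by
    intro x
    rw [Finset.prod_ite, Finset.prod_const, Finset.prod_const]
    congr 2
    have := Finset.card_filter_add_card_filter_not (s := (Finset.univ : Finset (Fin n)))
      (fun a => x a ≠ 0)
    rw [Finset.card_univ, Fintype.card_fin] at this
    rw [hammingNorm]
    omega
  simp only [h]
  have h1 := Finset.prod_univ_sum (fun _ : Fin n => (Finset.univ : Finset (ZMod 2)))
    (fun _ b => if b ≠ 0 then p else 1 - p)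
  rw [Fintype.piFinset_univ] at h1
  rw [← h1]
  have h2 : ∑ b : ZMod 2, (if b ≠ 0 then p else 1 - p) = 1 := by
    rw [show (Finset.univ : Finset (ZMod 2)) = {0, 1} from rfl, Finset.sum_pair (by decide)]
    simp
  rw [Finset.prod_congr rfl fun _ _ => h2, Finset.prod_const_one]

/-- Under independent bits with bias `p = t / n ≤ 1 / 2`, each string of weight less than `t` has
probability at least `p ^ t * (1 - p) ^ (n - t)`, which is `2 ^ (-n H₂(p))`; these probabilities add
up to at most 1. -/
theorem card_hammingNorm_lt_le {n t : ℕ} (hn : 0 < n) (ht : (t : ℝ) ≤ (n : ℝ) / 2) :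
    ((Finset.univ.filter fun x : Bits n => hammingNorm x < t).card : ℝ) ≤
      (2 : ℝ) ^ ((n : ℝ) * H₂ ((t : ℝ) / n)) := by
  rcases Nat.eq_zero_or_pos t with rfl | ht0
  · simp only [not_lt_zero, Finset.filter_false, Finset.card_empty, Nat.cast_zero]
    positivity
  set p : ℝ := (t : ℝ) / n with hp
  have hn' : (0 : ℝ) < n := by exact_mod_cast hn
  have hp0 : 0 < p := by positivity
  have hp1 : p ≤ 1 / 2 := by
    rw [hp, div_le_iff₀ hn']
    linarith
  have hq0 : 0 < 1 - p := by linarith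
  have htn : t ≤ n := by
    have : (t : ℝ) ≤ n := by linarith
    exact_mod_cast this
  have hpow : (2 : ℝ) ^ ((n : ℝ) * H₂ p) = (p ^ t * (1 - p) ^ (n - t))⁻¹ := by
    have h1 : (n : ℝ) * p = t := by rw [hp]; field_simp
    have h2 : (n : ℝ) * H₂ p = -(Real.logb 2 p * t) + -(Real.logb 2 (1 - p) * ((n - t : ℕ) : ℝ)) := by
      rw [H₂, Nat.cast_sub htn, ← h1]
      ring
    rw [h2, Real.rpow_add two_pos, Real.rpow_neg two_pos.le, Real.rpow_neg two_pos.le,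
      Real.rpow_mul two_pos.le, Real.rpow_mul two_pos.le,
      Real.rpow_logb two_pos (by norm_num) hp0, Real.rpow_logb two_pos (by norm_num) hq0,
      Real.rpow_natCast, Real.rpow_natCast, mul_inv]
  rw [hpow, ← one_div, le_div_iff₀ (by positivity), ← nsmul_eq_mul, ← Finset.sum_const]
  refine le_trans (Finset.sum_le_sum fun x hx => ?_)
    ((Finset.sum_le_sum_of_subset_of_nonneg (Finset.filter_subset (fun x => hammingNorm x < t) _)
      fun x _ _ => by positivity).trans_eq (sum_pow_hammingNorm n p))
  have hx' := (Finset.mem_filter.1 hx).2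
  -- The two products differ in `t - hammingNorm x` factors, which are `p` in one and `1 - p ≥ p` in
  -- the other.
  have h1 : t = hammingNorm x + (t - hammingNorm x) := by omega
  have h2 : n - hammingNorm x = (t - hammingNorm x) + (n - t) := by omega
  rw [h2, pow_add (1 - p), ← mul_assoc]
  refine mul_le_mul_of_nonneg_right ?_ (by positivity)
  conv_lhs => rw [h1, pow_add]
  gcongr
  linarith

/-! ### INFO and TEST bits -/

namespace InfoString

variable {N n : ℕ} (s : InfoString N n)

theorem apply_infoIso (a : Fin n) : s.1 (s.infoIso a) = 1 :=
  (bit_cases _).resolve_left (Finset.mem_filter.1 (s.infoIso a).2).2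

theorem apply_testIso (a : Fin (N - n)) : s.1 (s.testIso a) = 0 :=
  (Finset.mem_filter.1 (s.testIso a).2).2

theorem merge_infoIso (xI : Bits n) (xT : Bits (N - n)) (a : Fin n) :
    s.merge xI xT (s.infoIso a) = xI a :=
  congrFun (s.info_merge xI xT) a

theorem merge_testIso (xI : Bits n) (xT : Bits (N - n)) (a : Fin (N - n)) :
    s.merge xI xT (s.testIso a) = xT a :=
  congrFun (s.test_merge xI xT) a

theorem ext_info_test {x y : Bits N} (hI : s.info x = s.info y) (hT : s.test x = s.test y) :
    x = y := by
  funext p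
  by_cases h : s.1 p = 0
  · have := congrFun hT (s.testIso.symm ⟨p, by simpa [testSet] using h⟩)
    simpa [test] using this
  · have := congrFun hI (s.infoIso.symm ⟨p, by simpa [infoSet] using h⟩)
    simpa [info] using this

theorem merge_info_test (x : Bits N) : s.merge (s.info x) (s.test x) = x :=
  s.ext_info_test (s.info_merge _ _) (s.test_merge _ _)

theorem merge_add (xI yI : Bits n) (xT yT : Bits (N - n)) :
    s.merge (xI + yI) (xT + yT) = s.merge xI xT + s.merge yI yT := by
  refine s.ext_info_test ?_ ?_
  · rw [info_merge]
    funext a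
    simp [info, merge_infoIso]
  · rw [test_merge]
    funext a
    simp [test, merge_testIso]

theorem prod_eq {M : Type*} [CommMonoid M] (f : Fin N → M) :
    ∏ p, f p = (∏ a, f (s.infoIso a)) * ∏ a, f (s.testIso a) := by
  rw [← Finset.prod_filter_mul_prod_filter_not Finset.univ (fun p => s.1 p ≠ 0) f]
  congr 1
  · refine (Finset.prod_coe_sort s.infoSet f).symm.trans ?_
    exact (Fintype.prod_equiv s.infoIso.toEquiv _ (fun q : s.infoSet => f q) fun _ => rfl).symm
  · simp only [not_not]
    refine (Finset.prod_coe_sort s.testSet f).symm.trans ?_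
    exact (Fintype.prod_equiv s.testIso.toEquiv _ (fun q : s.testSet => f q) fun _ => rfl).symm

open Classical in
theorem sum_ite_test {M : Type*} [AddCommMonoid M] (xT : Bits (N - n)) (f : Bits N → M) :
    ∑ x, (if s.test x = xT then f x else 0) = ∑ xI, f (s.merge xI xT) := by
  rw [← Finset.sum_filter]
  refine Finset.sum_bij' (fun x _ => s.info x) (fun xI _ => s.merge xI xT) ?_ ?_ ?_ ?_ ?_
  · simp
  · simp [test_merge]
  · intro x hx
    rw [← (Finset.mem_filter.1 hx).2, merge_info_test]
  · simp [info_merge]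
  · intro x hx
    rw [← (Finset.mem_filter.1 hx).2, merge_info_test]

end InfoString

/-! ### The inverted basis -/

/-- Flipping the basis bit is the Hadamard transform. -/
theorem qubitAmp_add_one (b x z : ZMod 2) :
    qubitAmp (b + 1) x z =
      (Real.sqrt 2 : ℂ)⁻¹ * ∑ y : ZMod 2, (-1 : ℂ) ^ (x * y).val * qubitAmp b y z := by
  have h : (1 : ZMod 2) + 1 = 0 := rfl
  have h1 : (1 : ZMod 2).val = 1 := rfl
  have h2 : (Real.sqrt 2 : ℂ)⁻¹ * (Real.sqrt 2 : ℂ)⁻¹ = 2⁻¹ := by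
    rw [← mul_inv, ← Complex.ofReal_mul, Real.mul_self_sqrt zero_le_two, Complex.ofReal_ofNat]
  rw [show (Finset.univ : Finset (ZMod 2)) = {0, 1} from rfl, Finset.sum_pair (by decide)]
  rcases bit_cases b with rfl | rfl <;> rcases bit_cases x with rfl | rfl <;>
    rcases bit_cases z with rfl | rfl <;>
    simp [qubitAmp, h, h1, div_eq_mul_inv, mul_add, h2] <;> norm_num

/-- Adding `s` flips the basis exactly at the INFO positions, so the product state is
Hadamard-transformed there and unchanged on the TEST bits. -/
theorem ket_add_merge {N n : ℕ} (b : Bits N) (s : InfoString N n) (xI : Bits n)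
    (xT : Bits (N - n)) :
    ket (b + s.1) (s.merge xI xT) =
      (Real.sqrt 2 : ℂ)⁻¹ ^ n • ∑ y, sgn xI y • ket b (s.merge y xT) := by
  ext z
  rw [PiLp.smul_apply, WithLp.ofLp_sum, Finset.sum_apply]
  simp only [PiLp.smul_apply, smul_eq_mul, ket, s.prod_eq, s.merge_infoIso, s.merge_testIso,
    Pi.add_apply, s.apply_infoIso, s.apply_testIso, add_zero, qubitAmp_add_one,
    Finset.prod_mul_distrib, Finset.prod_const, Finset.card_univ, Fintype.card_fin]
  rw [mul_assoc, Finset.prod_univ_sum, Fintype.piFinset_univ, Finset.sum_mul]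
  congr 1
  refine Finset.sum_congr rfl fun y _ => ?_
  rw [Finset.prod_mul_distrib, ← sgn_eq_prod, mul_assoc]

section Linearity

variable {K X : Type*} [NormedAddCommGroup K] [InnerProductSpace ℂ K]

theorem tensorVec_smul (v : K) (c : ℂ) (q : EuclideanSpace ℂ X) :
    tensorVec v (c • q) = c • tensorVec v q := by
  ext x
  simp [tensorVec, mul_smul]

theorem tensorVec_sum {α : Type*} (F : Finset α) (v : K) (q : α → EuclideanSpace ℂ X) :
    tensorVec v (∑ a ∈ F, q a) = ∑ a ∈ F, tensorVec v (q a) := by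
  ext x
  simp [tensorVec, Finset.sum_smul]

variable [Fintype X]

theorem partialInner_smul_left (c : ℂ) (q : EuclideanSpace ℂ X) (ψ : Composite K X) :
    partialInner (c • q) ψ = (starRingEnd ℂ) c • partialInner q ψ := by
  simp [partialInner, mul_smul, Finset.smul_sum]

theorem partialInner_sum_left {α : Type*} (F : Finset α) (q : α → EuclideanSpace ℂ X)
    (ψ : Composite K X) : partialInner (∑ a ∈ F, q a) ψ = ∑ a ∈ F, partialInner (q a) ψ := by
  simp only [partialInner, WithLp.ofLp_sum, Finset.sum_apply, map_sum, Finset.sum_smul]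
  exact Finset.sum_comm

theorem partialInner_smul_right (c : ℂ) (q : EuclideanSpace ℂ X) (ψ : Composite K X) :
    partialInner q (c • ψ) = c • partialInner q ψ := by
  simp [partialInner, Finset.smul_sum, smul_comm c]

theorem partialInner_sum_right {α : Type*} (F : Finset α) (q : EuclideanSpace ℂ X)
    (ψ : α → Composite K X) : partialInner q (∑ a ∈ F, ψ a) = ∑ a ∈ F, partialInner q (ψ a) := by
  simp only [partialInner, WithLp.ofLp_sum, Finset.sum_apply, Finset.smul_sum]
  exact Finset.sum_comm

end Linearity

namespace Attack

variable {N n : ℕ} {H : Type*} [NormedAddCommGroup H] [InnerProductSpace ℂ H]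

theorem probeState_add_merge (A : Attack N H) (b : Bits N) (s : InfoString N n) (x y : Bits n)
    (iT jT : Bits (N - n)) :
    A.probeState (b + s.1) (s.merge x iT) (s.merge y jT) =
      ((2 : ℂ) ^ n)⁻¹ • ∑ i, ∑ j, (sgn x i * sgn y j) •
        A.probeState b (s.merge i iT) (s.merge j jT) := by
  have h2 : (Real.sqrt 2 : ℂ)⁻¹ ^ n * (Real.sqrt 2 : ℂ)⁻¹ ^ n = ((2 : ℂ) ^ n)⁻¹ := by
    rw [← mul_pow, ← mul_inv, ← Complex.ofReal_mul, Real.mul_self_sqrt zero_le_two,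
      Complex.ofReal_ofNat, inv_pow]
  simp only [probeState, ket_add_merge, tensorVec_smul, tensorVec_sum, map_smul, map_sum,
    partialInner_smul_left, partialInner_sum_left, partialInner_smul_right, partialInner_sum_right,
    conj_sgn, map_pow, map_inv₀, Complex.conj_ofReal]
  simp only [smul_smul, Finset.smul_sum, ← h2]
  refine Finset.sum_congr rfl fun i _ => Finset.sum_congr rfl fun j _ => ?_
  congr 1
  ring

/-- `|E'_{i,j}⟩_b` as a function of the INFO bits `x` of `i` and of the difference `c` of the INFO
bits of `i` and `j`. -/
def infoProbeState (A : Attack N H) (b : Bits N) (s : InfoString N n) (iT jT : Bits (N - n))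
    (c x : Bits n) : H :=
  A.probeState b (s.merge x iT) (s.merge (x + c) jT)

/-- The inverted probe states are a double Fourier transform of the real ones. After the
substitution `j = i + c`, the sum over `i` is the Fourier coefficient at the error string `l`, and
what remains is a Fourier series in `x` indexed by `c`, to which Parseval applies. -/
theorem sum_measureProb_add_merge (A : Attack N H) (b : Bits N) (s : InfoString N n)
    (iT jT : Bits (N - n)) (l : Bits n) :
    ∑ x, A.measureProb (b + s.1) (s.merge x iT) (s.merge (x + l) jT) =
      2 ^ n * ∑ c, ‖fourier (A.infoProbeState b s iT jT c) l‖ ^ 2 := by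
  have h : ∀ x, A.probeState (b + s.1) (s.merge x iT) (s.merge (x + l) jT) =
      ∑ c, sgn x c • sgn l c • fourier (A.infoProbeState b s iT jT c) l := by
    intro x
    rw [probeState_add_merge, Finset.smul_sum]
    simp only [fourier, Finset.smul_sum]
    rw [Finset.sum_comm (s := Finset.univ (α := Bits n))]
    conv_rhs => rw [Finset.sum_comm]
    rw [Finset.sum_comm]
    refine Finset.sum_congr rfl fun i _ => ?_
    rw [← Equiv.sum_comp (Equiv.addLeft i)]
    refine Finset.sum_congr rfl fun c _ => ?_
    rw [Equiv.coe_addLeft, infoProbeState]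
    simp only [smul_smul]
    congr 1
    rw [sgn_add_left, sgn_add_right, sgn_add_right, sgn_comm i l]
    linear_combination (((2 : ℂ) ^ n)⁻¹ * sgn x c * sgn l c * sgn l i) * sgn_mul_self x i
  simp only [measureProb, h, sum_norm_sq_sum_sgn]
  simp [norm_smul, norm_sgn]

/-! ### The symmetrized attack -/

/-- The register `M` acts as a control: given `m`, the sent and measured strings are both shifted by
`m`, and the phases `(i ⊕ b) · m` and `(j ⊕ b) · m` combine to `(i ⊕ j) · m`. -/
theorem sym_probeState_apply (A : Attack N H) (b i j m : Bits N) :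
    A.sym.probeState b i j m =
      ((Real.sqrt (2 ^ N))⁻¹ : ℂ) • sgn (i + j) m • A.probeState b (i + m) (j + m) := by
  have key : ∀ i x : Bits N, sgn (x + m) m * ket b i (x + m) = sgn (i + b) m * ket b (i + m) x := by
    intro i x
    simp only [sgn_eq_prod, ket, ← Finset.prod_mul_distrib]
    exact Finset.prod_congr rfl fun p _ => qubitAmp_shift (b p) (i p) (x p) (m p)
  have hc : ∀ j x : Bits N, (starRingEnd ℂ) (ket b j (x + m)) * sgn (x + m) m =
      sgn (j + b) m * (starRingEnd ℂ) (ket b (j + m) x) := by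
    intro j x
    have h := congrArg (starRingEnd ℂ) (key j x)
    rwa [map_mul, map_mul, conj_sgn, conj_sgn, mul_comm] at h
  have hU : ∀ x, A.sym.unitary (tensorVec A.sym.probe (ket b i)) x m =
      (((Real.sqrt (2 ^ N))⁻¹ : ℂ) * (sgn x m * sgn (i + b) m)) •
        A.unitary (tensorVec A.probe (ket b (i + m))) (x + m) := by
    intro x
    change sgn x m • A.unitary (WithLp.toLp 2 fun y => sgn (y + m) m • ket b i (y + m) •
      ((Real.sqrt (2 ^ N))⁻¹ : ℂ) • A.probe) (x + m) = _
    have h1 : (WithLp.toLp 2 fun y => sgn (y + m) m • ket b i (y + m) •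
        ((Real.sqrt (2 ^ N))⁻¹ : ℂ) • A.probe : Composite H (Bits N)) =
        (((Real.sqrt (2 ^ N))⁻¹ : ℂ) * sgn (i + b) m) • tensorVec A.probe (ket b (i + m)) := by
      ext y
      change _ = (((Real.sqrt (2 ^ N))⁻¹ : ℂ) * sgn (i + b) m) • ket b (i + m) y • A.probe
      rw [PiLp.toLp_apply, smul_smul, smul_smul, smul_smul, key]
      congr 1
      ring
    rw [h1, map_smul, PiLp.smul_apply, smul_smul]
    congr 1
    ring
  have hL : A.sym.probeState b i j m = ∑ x, (starRingEnd ℂ) (ket b j x) •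
      A.sym.unitary (tensorVec A.sym.probe (ket b i)) x m := by
    rw [probeState, partialInner, WithLp.ofLp_sum, Finset.sum_apply]
    rfl
  rw [hL, probeState, partialInner, Finset.smul_sum, Finset.smul_sum,
    ← Equiv.sum_comp (Equiv.addRight m)]
  refine Finset.sum_congr rfl fun x _ => ?_
  rw [Equiv.coe_addRight, hU, add_assoc x, bits_add_self, add_zero, smul_smul, smul_smul, smul_smul]
  congr 1
  have h2 : sgn (j + b) m * sgn (i + b) m = sgn (i + j) m := by
    rw [sgn_add_left, sgn_add_left, sgn_add_left]
    linear_combination (sgn j m * sgn i m) * sgn_mul_self b m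
  rw [← h2]
  linear_combination (((Real.sqrt (2 ^ N))⁻¹ : ℂ) * sgn (i + b) m) * hc j x

/-- Shifting both strings by `a` shifts the label of the register `M` and contributes the sign
`(-1)^{d · a}`. The resulting isometry depends on `a` and `d` but not on `i`. -/
theorem sym_probeState_translate (A : Attack N H) (b a : Bits N) (d : Bits N) :
    ∃ τ : Composite H (Bits N) →ₗᵢ[ℂ] Composite H (Bits N), ∀ i,
      A.sym.probeState b (i + a) (i + a + d) = τ (A.sym.probeState b i (i + d)) := by
  let τ₀ : Composite H (Bits N) →ₗᵢ[ℂ] Composite H (Bits N) :=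
    (LinearIsometryEquiv.piLpCongrLeft 2 ℂ H (Equiv.addRight a).symm).toLinearIsometry
  refine ⟨⟨sgn d a • τ₀.toLinearMap, fun v => ?_⟩, fun i => ?_⟩
  · simp [norm_smul, norm_sgn]
  · ext m
    have hτ : ∀ v : Composite H (Bits N), τ₀ v m = v (m + a) := by
      intro v
      simp only [τ₀, LinearIsometryEquiv.coe_toLinearIsometry,
        LinearIsometryEquiv.piLpCongrLeft_apply]
      rfl
    change _ = sgn d a • τ₀ _ m
    rw [hτ, sym_probeState_apply, sym_probeState_apply, smul_comm (sgn d a), smul_smul (sgn d a)]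
    have e1 : i + (m + a) = i + a + m := by abel
    have e2 : i + d + (m + a) = i + a + d + m := by abel
    have e3 : i + (i + d) = d := by rw [← add_assoc, bits_add_self, zero_add]
    have e4 : i + a + (i + a + d) = d := by rw [← add_assoc, bits_add_self, zero_add]
    rw [e1, e2, e3, e4, sgn_add_right, mul_comm (sgn d m), ← mul_assoc, sgn_mul_self, one_mul]

end Attack

/-! ### Probabilities -/

section Law

variable {N n : ℕ} {H : Type*} [NormedAddCommGroup H] [InnerProductSpace ℂ H]

open Classical in
-- The prefactor depends neither on `Q` nor on `v`, so it cancels in conditional probabilities.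
theorem prob_inter_publicEvent (v : Version) (r m : ℕ) (law : PMF (Bits N × InfoString N n))
    (A : Attack N H) (b : Bits N) (s : InfoString N n) (iT jT : Bits (N - n))
    (Q : Bits n → Bits n → Prop) :
    prob v r m law A ({ω | Q (ω.s.info ω.i) (ω.s.info ω.j)} ∩ publicEvent r m iT jT b s) =
      (1 / 2 ^ N) * (law (b, s)).toReal * (∑ _P : KeyMatrices n r m, keyMatricesProb n r m) *
        ∑ x, ∑ y, if Q x y then
          A.measureProb (v.usedBasis b s) (s.merge x iT) (s.merge y jT) else 0 := by
  have h1 : ∀ i, (∑ b' : Bits N, ∑ s' : InfoString N n, ∑ P : KeyMatrices n r m, ∑ j,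
      if (⟨i, b', s', P, j⟩ : Outcome N n r m) ∈
        ({ω | Q (ω.s.info ω.i) (ω.s.info ω.j)} ∩ publicEvent r m iT jT b s : Set (Outcome N n r m))
      then outcomeProb v r m law A ⟨i, b', s', P, j⟩ else 0) =
      (1 / 2 ^ N) * (law (b, s)).toReal * (∑ _P : KeyMatrices n r m, keyMatricesProb n r m) *
      if s.test i = iT then ∑ y, if Q (s.info i) y then
        A.measureProb (v.usedBasis b s) i (s.merge y jT) else 0 else 0 := by
    intro i
    rw [Finset.sum_eq_single b _ (by simp), Finset.sum_eq_single s _ (by simp)]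
    · rw [Finset.mul_sum, Finset.sum_mul]
      refine Finset.sum_congr rfl fun P _ => ?_
      have h2 := s.sum_ite_test jT fun j => if Q (s.info i) (s.info j) then
        A.measureProb (v.usedBasis b s) i j else 0
      simp only [s.info_merge] at h2
      rw [← h2]
      split_ifs with hi
      · rw [Finset.mul_sum]
        refine Finset.sum_congr rfl fun j _ => ?_
        by_cases hj : s.test j = jT <;> by_cases hQ : Q (s.info i) (s.info j) <;>
          simp [publicEvent, outcomeProb, hi, hj, hQ]
      · rw [mul_zero]
        exact Finset.sum_eq_zero fun j _ => if_neg fun h => hi h.2.1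
    · intro s' _ hs
      refine Finset.sum_eq_zero fun P _ => Finset.sum_eq_zero fun j _ => if_neg ?_
      exact fun h => hs h.2.2.2.2
    · intro b' _ hb
      refine Finset.sum_eq_zero fun s' _ => Finset.sum_eq_zero fun P _ =>
        Finset.sum_eq_zero fun j _ => if_neg ?_
      exact fun h => hb h.2.2.2.1
  rw [prob]
  refine (Finset.sum_congr rfl fun i _ => Eq.trans ?_ (h1 i)).trans ?_
  · congr!
  · rw [← Finset.mul_sum, s.sum_ite_test]
    simp only [s.info_merge]

end Law

/-! ### Operators of bounded nuclear norm -/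

section Nuclear

variable {K : Type*} [NormedAddCommGroup K] [InnerProductSpace ℂ K]

/-- `T` is a finite sum of operators `|x⟩⟨y|` with `∑ ‖x‖ ‖y‖ ≤ B`. -/
def NuclearBound (T : K →L[ℂ] K) (B : ℝ) : Prop :=
  ∃ L : List (K × K), T = (L.map fun z => InnerProductSpace.rankOne ℂ z.1 z.2).sum ∧
    (L.map fun z => ‖z.1‖ * ‖z.2‖).sum ≤ B

namespace NuclearBound

theorem mono {T : K →L[ℂ] K} {B B' : ℝ} (h : NuclearBound T B) (hB : B ≤ B') :
    NuclearBound T B' := by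
  obtain ⟨L, hL, hLB⟩ := h
  exact ⟨L, hL, hLB.trans hB⟩

theorem rankOne (x y : K) : NuclearBound (InnerProductSpace.rankOne ℂ x y) (‖x‖ * ‖y‖) :=
  ⟨[(x, y)], by simp, by simp⟩

theorem add {T T' : K →L[ℂ] K} {B B' : ℝ} (h : NuclearBound T B) (h' : NuclearBound T' B') :
    NuclearBound (T + T') (B + B') := by
  obtain ⟨L, hL, hLB⟩ := h
  obtain ⟨L', hL', hLB'⟩ := h'
  refine ⟨L ++ L', ?_, ?_⟩
  · rw [List.map_append, List.sum_append, hL, hL']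
  · rw [List.map_append, List.sum_append]
    exact add_le_add hLB hLB'

theorem sum {α : Type*} (F : Finset α) (T : α → K →L[ℂ] K) (B : α → ℝ)
    (h : ∀ a ∈ F, NuclearBound (T a) (B a)) : NuclearBound (∑ a ∈ F, T a) (∑ a ∈ F, B a) := by
  classical
  induction F using Finset.induction_on with
  | empty => exact ⟨[], by simp, by simp⟩
  | insert a F ha ih =>
    rw [Finset.sum_insert ha, Finset.sum_insert ha]
    exact (h a (Finset.mem_insert_self a F)).add
      (ih fun a' ha' => h a' (Finset.mem_insert_of_mem ha'))

theorem smul {T : K →L[ℂ] K} {B : ℝ} (c : ℂ) (h : NuclearBound T B) :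
    NuclearBound (c • T) (‖c‖ * B) := by
  obtain ⟨L, hL, hLB⟩ := h
  refine ⟨L.map fun z => (c • z.1, z.2), ?_, ?_⟩
  · rw [hL, List.smul_sum, List.map_map, List.map_map]
    congr 1
    refine List.map_congr_left fun z _ => ?_
    simp
  · rw [List.map_map]
    refine le_trans (le_of_eq ?_) (mul_le_mul_of_nonneg_left hLB (norm_nonneg c))
    rw [← List.sum_map_mul_left]
    congr 1
    refine List.map_congr_left fun z _ => ?_
    simp [norm_smul, mul_assoc]

theorem sub {T T' : K →L[ℂ] K} {B B' : ℝ} (h : NuclearBound T B) (h' : NuclearBound T' B') :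
    NuclearBound (T - T') (B + B') := by
  have := h.add (h'.smul (-1))
  simpa [sub_eq_add_neg] using this

/-- Bounds on rank-one decompositions add and scale, so the estimates are made on decompositions and
converted to the trace norm only once. -/
theorem traceNorm_le [CompleteSpace K] {T : K →L[ℂ] K} {B : ℝ} (h : NuclearBound T B)
    (hT : IsSelfAdjoint T) : traceNorm T ≤ ENNReal.ofReal B := by
  obtain ⟨L, hL, hLB⟩ := h
  refine (BB84.traceNorm_le T hT (fun i : Fin L.length => L[i].1) (fun i => L[i].2) ?_).trans
    (ENNReal.ofReal_le_ofReal (le_trans (le_of_eq ?_) hLB))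
  · rw [hL]
    exact (Fin.sum_univ_fun_getElem L fun z => InnerProductSpace.rankOne ℂ z.1 z.2).symm
  · exact Fin.sum_univ_fun_getElem L fun z => ‖z.1‖ * ‖z.2‖

end NuclearBound

variable {X : Type*} [DecidableEq X]

theorem tensorProj_apply (T : K →L[ℂ] K) (x : X) (ψ : Composite K X) :
    tensorProj T x ψ = WithLp.toLp 2 (Pi.single x (T (ψ x))) := rfl

theorem tensorProj_zero (x : X) : tensorProj (0 : K →L[ℂ] K) x = 0 := by
  ext ψ y
  simp [tensorProj_apply]

variable [Fintype X]

theorem tensorProj_add (T T' : K →L[ℂ] K) (x : X) :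
    tensorProj (T + T') x = tensorProj T x + tensorProj T' x := by
  ext ψ y
  simp [tensorProj_apply, Pi.single_add]

theorem tensorProj_sub (T T' : K →L[ℂ] K) (x : X) :
    tensorProj (T - T') x = tensorProj T x - tensorProj T' x := by
  ext ψ y
  simp [tensorProj_apply, Pi.single_sub]

theorem tensorProj_sum {α : Type*} (F : Finset α) (T : α → K →L[ℂ] K) (x : X) :
    tensorProj (∑ a ∈ F, T a) x = ∑ a ∈ F, tensorProj (T a) x := by
  classical
  induction F using Finset.induction_on with
  | empty => simp [tensorProj_zero]
  | insert a F ha ih => rw [Finset.sum_insert ha, Finset.sum_insert ha, tensorProj_add, ih]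

theorem tensorProj_rankOne (u v : K) (x : X) :
    tensorProj (InnerProductSpace.rankOne ℂ u v) x =
      InnerProductSpace.rankOne ℂ (WithLp.toLp 2 (Pi.single x u) : Composite K X)
        (WithLp.toLp 2 (Pi.single x v)) := by
  ext ψ y
  have h : ⟪(WithLp.toLp 2 (Pi.single x v) : Composite K X), ψ⟫_ℂ = ⟪v, ψ x⟫_ℂ := by
    rw [PiLp.inner_apply, Finset.sum_eq_single x _ (by simp)]
    · simp
    · intro z _ hz
      simp [hz]
  rw [tensorProj_apply, InnerProductSpace.rankOne_apply, InnerProductSpace.rankOne_apply, h,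
    Pi.single_smul]
  rfl

/-- The embedding of `K` as the component at `x` is isometric, so a decomposition carries over with
the same norms. -/
theorem NuclearBound.tensorProj {T : K →L[ℂ] K} {B : ℝ} (h : NuclearBound T B) (x : X) :
    NuclearBound (tensorProj T x) B := by
  obtain ⟨L, rfl, hLB⟩ := h
  refine NuclearBound.mono (B := (L.map fun z => ‖z.1‖ * ‖z.2‖).sum) ?_ hLB
  clear hLB
  induction L with
  | nil => exact ⟨[], by simp [tensorProj_zero], by simp⟩
  | cons z L ih =>
    rw [List.map_cons, List.map_cons, List.sum_cons, List.sum_cons, tensorProj_add,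
      tensorProj_rankOne]
    refine NuclearBound.add ((NuclearBound.rankOne _ _).mono (le_of_eq ?_)) ih
    rw [PiLp.toLp_single, PiLp.toLp_single, PiLp.norm_single, PiLp.norm_single]

end Nuclear

/-! ### Independence of the key -/

section Core

variable {n r m : ℕ} {K : Type*} [NormedAddCommGroup K] [InnerProductSpace ℂ K]

/-- A mixture of the pure states `e c x`, averaged over all `x` with given syndrome and key, does
not depend on the key if the spectrum of the states meets each coset of the row span at most
once. -/
theorem sum_rankOne_fourierPart (P : KeyMatrices n r m) (ξ : Bits r) (k : Bits m)
    (G : Finset (Bits n)) (hG : ∀ l ∈ G, ∀ l' ∈ G, l + l' ∈ P.rowSpan → l = l') (f : Bits n → K) :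
    ∑ x ∈ P.fiber ξ k, InnerProductSpace.rankOne ℂ (fourierPart G f x) (fourierPart G f x) =
      ((2 : ℂ) ^ (n - r - m)) • ∑ l ∈ G, InnerProductSpace.rankOne ℂ (fourier f l) (fourier f l) := by
  have h1 : ∀ x, InnerProductSpace.rankOne ℂ (fourierPart G f x) (fourierPart G f x) =
      ∑ l ∈ G, ∑ l' ∈ G, sgn x (l + l') •
        InnerProductSpace.rankOne ℂ (fourier f l) (fourier f l') := by
    intro x
    simp only [fourierPart, map_sum, sum_apply, map_smul, map_smulₛₗ,
      conj_sgn, sgn_add_right, mul_smul, Finset.smul_sum, smul_apply]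
    rw [Finset.sum_comm]
    exact Finset.sum_congr rfl fun l _ => Finset.sum_congr rfl fun l' _ => smul_comm _ _ _
  simp only [h1]
  rw [Finset.sum_comm, Finset.smul_sum]
  refine Finset.sum_congr rfl fun l hl => ?_
  -- For `l' ≠ l` in `G`, `l + l'` is outside the row span, so its signs cancel over the fiber. The
  -- diagonal term only counts the fiber, whose size is the same for all keys.
  rw [Finset.sum_comm, Finset.sum_eq_single l]
  · simp only [bits_add_self, sgn_zero_right, one_smul, Finset.sum_const, P.card_fiber]
    rw [← Nat.cast_smul_eq_nsmul ℂ]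
    norm_cast
  · intro l' hl' hne
    rw [← Finset.sum_smul, P.sum_sgn_fiber ξ k fun h => hne (hG l hl l' hl' h).symm, zero_smul]
  · exact fun h => absurd hl h

variable (e : Bits n → Bits n → K)

/-- The spectral weight at `l` of the family of vectors `e`. -/
def spectralWeight (l : Bits n) : ℝ := ∑ c, ‖fourier (e c) l‖ ^ 2

theorem spectralWeight_nonneg (l : Bits n) : 0 ≤ spectralWeight e l :=
  Finset.sum_nonneg fun _ _ => sq_nonneg _

/-- By Plancherel, the spectral weights form a probability distribution. -/
theorem sum_spectralWeight (h1 : ∀ x, ∑ c, ‖e c x‖ ^ 2 = 1) : ∑ l, spectralWeight e l = 1 := by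
  have h : (2 : ℝ) ^ n * ∑ l, spectralWeight e l = 2 ^ n * 1 := by
    simp only [spectralWeight]
    rw [Finset.sum_comm, Finset.mul_sum]
    simp only [sum_norm_sq_fourier]
    rw [Finset.sum_comm]
    simp [h1, ZMod.card]
  exact mul_left_cancel₀ (by positivity) h

variable {e}

/-- With `g` the truncation of `e`, `|e⟩⟨e| - |g⟩⟨g| = |e - g⟩⟨e| + |g⟩⟨e - g|`. Cauchy–Schwarz over
`c` bounds each half by `√(∑ ‖e - g‖²)`, and translation invariance identifies this sum, at every
single `x`, with the weight outside `G`. -/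
theorem nuclearBound_sub_fourierPart
    (hτ : ∀ c a, ∃ τ : K →ₗᵢ[ℂ] K, ∀ x, e c (x + a) = τ (e c x))
    (h1 : ∀ x, ∑ c, ‖e c x‖ ^ 2 = 1) (G : Finset (Bits n)) (x : Bits n) :
    NuclearBound (∑ c, InnerProductSpace.rankOne ℂ (e c x) (e c x) -
      ∑ c, InnerProductSpace.rankOne ℂ (fourierPart G (e c) x) (fourierPart G (e c) x))
      (2 * √(∑ l ∈ Gᶜ, spectralWeight e l)) := by
  set g := fun c => fourierPart G (e c) x
  have hnorm : ∀ G' : Finset (Bits n), ∑ c, ‖fourierPart G' (e c) x‖ ^ 2 =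
      ∑ l ∈ G', spectralWeight e l := by
    intro G'
    simp only [fun c => norm_sq_fourierPart G' (e c) (hτ c) x, spectralWeight]
    exact Finset.sum_comm
  have hg : ∑ c, ‖g c‖ ^ 2 ≤ 1 := by
    rw [hnorm, ← sum_spectralWeight e h1]
    exact Finset.sum_le_sum_of_subset_of_nonneg (Finset.subset_univ _)
      fun l _ _ => spectralWeight_nonneg e l
  have hd : ∑ c, ‖e c x - g c‖ ^ 2 = ∑ l ∈ Gᶜ, spectralWeight e l := by
    simp only [g, sub_fourierPart, hnorm]
  have hsplit : ∑ c, InnerProductSpace.rankOne ℂ (e c x) (e c x) -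
      ∑ c, InnerProductSpace.rankOne ℂ (g c) (g c) =
      ∑ c, (InnerProductSpace.rankOne ℂ (e c x - g c) (e c x) +
        InnerProductSpace.rankOne ℂ (g c) (e c x - g c)) := by
    rw [← Finset.sum_sub_distrib]
    refine Finset.sum_congr rfl fun c _ => ?_
    simp
  rw [hsplit]
  refine (NuclearBound.sum _ _ (fun c => ‖e c x - g c‖ * ‖e c x‖ + ‖g c‖ * ‖e c x - g c‖)
    fun c _ => (NuclearBound.rankOne _ _).add (NuclearBound.rankOne _ _)).mono ?_
  rw [Finset.sum_add_distrib, two_mul]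
  refine add_le_add ?_ ?_
  · refine (Real.sum_mul_le_sqrt_mul_sqrt _ _ _).trans ?_
    rw [hd, h1, Real.sqrt_one, mul_one]
  · refine (Real.sum_mul_le_sqrt_mul_sqrt _ _ _).trans ?_
    rw [hd]
    exact mul_le_of_le_one_left (Real.sqrt_nonneg _) (Real.sqrt_le_one.2 hg)

open Classical in
/-- The strings of weight less than `t` that are the only ones of this kind in their coset of the
row span. -/
def KeyMatrices.leaders (P : KeyMatrices n r m) (t : ℕ) : Finset (Bits n) :=
  Finset.univ.filter fun l => hammingNorm l < t ∧
    ∀ l', hammingNorm l' < t → l + l' ∈ P.rowSpan → l = l'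

open Classical in
theorem KeyMatrices.mem_leaders {P : KeyMatrices n r m} {t : ℕ} {l : Bits n} :
    l ∈ P.leaders t ↔ hammingNorm l < t ∧
      ∀ l', hammingNorm l' < t → l + l' ∈ P.rowSpan → l = l' := by
  simp [leaders]

/-- The probability that a random string of law `spectralWeight e` is not determined by its coset
of a random code and the fact that its weight is less than `t`. -/
theorem sum_spectralWeight_compl_leaders_le (h1 : ∀ x, ∑ c, ‖e c x‖ ^ 2 = 1) (t : ℕ) :
    ∑ P : KeyMatrices n r m, keyMatricesProb n r m * ∑ l ∈ (P.leaders t)ᶜ, spectralWeight e l ≤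
      (∑ l : Bits n with t ≤ hammingNorm l, spectralWeight e l) +
        (Finset.univ.filter fun l : Bits n => hammingNorm l < t).card *
          ((2 : ℝ) ^ (r + m) / 2 ^ n) := by
  classical
  set q := keyMatricesProb n r m
  set S := Finset.univ.filter fun l : Bits n => hammingNorm l < t
  have hq : 0 ≤ q := keyMatricesProb_nonneg n r m
  have hw := spectralWeight_nonneg e
  -- A non-leader is either heavy or has a light competitor `l' ≠ l` in its coset; the sum is the
  -- union bound over competitors.
  have hP : ∀ (P : KeyMatrices n r m) (l : Bits n), (if l ∈ (P.leaders t)ᶜ then 1 else 0 : ℝ) ≤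
      (if t ≤ hammingNorm l then 1 else 0) +
        ∑ l' ∈ S.erase l, if l + l' ∈ P.rowSpan then 1 else 0 := by
    intro P l
    have h0 : ∀ l' ∈ S.erase l, (0 : ℝ) ≤ if l + l' ∈ P.rowSpan then 1 else 0 := by
      intro l' _
      split_ifs <;> norm_num
    by_cases hl : l ∈ (P.leaders t)ᶜ
    · rw [if_pos hl]
      by_cases ht : t ≤ hammingNorm l
      · rw [if_pos ht]
        exact le_add_of_nonneg_right (Finset.sum_nonneg h0)
      · rw [if_neg ht, zero_add]
        rw [Finset.mem_compl, KeyMatrices.mem_leaders] at hl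
        push Not at hl ht
        obtain ⟨l', hl', hmem, hne⟩ := hl ht
        refine le_trans ?_ (Finset.single_le_sum h0 (Finset.mem_erase.2
          ⟨hne.symm, Finset.mem_filter.2 ⟨Finset.mem_univ _, hl'⟩⟩))
        rw [if_pos hmem]
    · rw [if_neg hl]
      exact add_nonneg (by split_ifs <;> norm_num) (Finset.sum_nonneg h0)
  have hl : ∀ l : Bits n, ∑ P : KeyMatrices n r m, q * (if l ∈ (P.leaders t)ᶜ then 1 else 0 : ℝ) ≤
      (if t ≤ hammingNorm l then 1 else 0) + S.card * ((2 : ℝ) ^ (r + m) / 2 ^ n) := by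
    intro l
    calc ∑ P : KeyMatrices n r m, q * (if l ∈ (P.leaders t)ᶜ then 1 else 0 : ℝ)
        ≤ ∑ P : KeyMatrices n r m, q * ((if t ≤ hammingNorm l then 1 else 0) +
          ∑ l' ∈ S.erase l, if l + l' ∈ P.rowSpan then 1 else 0) :=
          Finset.sum_le_sum fun P _ => mul_le_mul_of_nonneg_left (hP P l) hq
      _ = (∑ _P : KeyMatrices n r m, q) * (if t ≤ hammingNorm l then 1 else 0) +
          ∑ l' ∈ S.erase l, ∑ P : KeyMatrices n r m, if l + l' ∈ P.rowSpan then q else 0 := by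
          rw [Finset.sum_comm (s := S.erase l), Finset.sum_mul, ← Finset.sum_add_distrib]
          simp only [mul_add, Finset.mul_sum, mul_ite, mul_one, mul_zero]
      _ ≤ 1 * (if t ≤ hammingNorm l then 1 else 0) +
          ∑ _l' ∈ S.erase l, (2 : ℝ) ^ (r + m) / 2 ^ n := by
          refine add_le_add (mul_le_mul_of_nonneg_right (sum_keyMatricesProb_le n r m)
            (by split_ifs <;> norm_num)) (Finset.sum_le_sum fun l' hl' => ?_)
          refine KeyMatrices.prob_mem_rowSpan_le fun h => (Finset.mem_erase.1 hl').1 ?_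
          exact (add_eq_zero_iff_eq_bits.1 h).symm
      _ ≤ (if t ≤ hammingNorm l then 1 else 0) + S.card * ((2 : ℝ) ^ (r + m) / 2 ^ n) := by
          rw [one_mul, Finset.sum_const, nsmul_eq_mul]
          gcongr
          exact Finset.erase_subset _ _
  calc ∑ P : KeyMatrices n r m, q * ∑ l ∈ (P.leaders t)ᶜ, spectralWeight e l
      = ∑ l, spectralWeight e l *
          ∑ P : KeyMatrices n r m, q * (if l ∈ (P.leaders t)ᶜ then 1 else 0 : ℝ) := by
        simp only [Finset.mul_sum]
        rw [Finset.sum_comm]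
        refine Finset.sum_congr rfl fun P _ => ?_
        simp only [mul_ite, mul_one, mul_zero, Finset.sum_ite_mem, Finset.univ_inter]
        exact Finset.sum_congr rfl fun l _ => mul_comm _ _
    _ ≤ ∑ l, spectralWeight e l *
          ((if t ≤ hammingNorm l then 1 else 0) + S.card * ((2 : ℝ) ^ (r + m) / 2 ^ n)) :=
        Finset.sum_le_sum fun l _ => mul_le_mul_of_nonneg_left (hl l) (hw l)
    _ = _ := by
        simp only [mul_add, Finset.sum_add_distrib, ← Finset.sum_mul, sum_spectralWeight e h1,
          one_mul, Finset.sum_filter, mul_ite, mul_one, mul_zero]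

end Core

/-! ### Eve's states after a symmetrized attack -/

section Sym

variable {N n : ℕ} {H : Type*} [NormedAddCommGroup H] [InnerProductSpace ℂ H]

theorem Attack.sym_infoProbeState_translate (A : Attack N H) (b : Bits N) (s : InfoString N n)
    (iT jT : Bits (N - n)) (c a : Bits n) :
    ∃ τ : Composite H (Bits N) →ₗᵢ[ℂ] Composite H (Bits N), ∀ x,
      A.sym.infoProbeState b s iT jT c (x + a) = τ (A.sym.infoProbeState b s iT jT c x) := by
  -- The shift leaves the TEST bits alone, and the difference string has INFO part `c` and TEST part
  -- `iT + jT`, which carries `iT` to `jT`.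
  obtain ⟨τ, hτ⟩ := A.sym_probeState_translate b (s.merge a 0) (s.merge c (iT + jT))
  refine ⟨τ, fun x => ?_⟩
  have h := hτ (s.merge x iT)
  rw [← s.merge_add, ← s.merge_add, ← s.merge_add, add_zero, ← add_assoc, bits_add_self,
    zero_add] at h
  exact h

theorem Attack.norm_sym_infoProbeState (A : Attack N H) (b : Bits N) (s : InfoString N n)
    (iT jT : Bits (N - n)) (c x y : Bits n) :
    ‖A.sym.infoProbeState b s iT jT c x‖ = ‖A.sym.infoProbeState b s iT jT c y‖ := by
  obtain ⟨τ, hτ⟩ := A.sym_infoProbeState_translate b s iT jT c (y + x)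
  have h : y + (y + x) = x := by rw [← add_assoc, bits_add_self, zero_add]
  have := hτ y
  rw [h] at this
  rw [this, τ.norm_map]

theorem Attack.testProb_eq (A : Attack N H) (b : Bits N) (s : InfoString N n)
    (iT jT : Bits (N - n)) (x : Bits n) :
    A.testProb b s iT jT x = ∑ c, ‖A.infoProbeState b s iT jT c x‖ ^ 2 := by
  rw [testProb, ← Equiv.sum_comp (Equiv.addLeft x)]
  rfl

/-- Thus Eve's states are all normalized by the same constant, which preserves their Fourier
structure. -/
theorem Attack.sym_testProb_eq (A : Attack N H) (b : Bits N) (s : InfoString N n)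
    (iT jT : Bits (N - n)) (x y : Bits n) :
    A.sym.testProb b s iT jT x = A.sym.testProb b s iT jT y := by
  rw [testProb_eq, testProb_eq]
  exact Finset.sum_congr rfl fun c _ => by rw [A.norm_sym_infoProbeState b s iT jT c x y]

theorem fourier_smul {K : Type*} [NormedAddCommGroup K] [InnerProductSpace ℂ K] (a : ℂ)
    (f : Bits n → K) (l : Bits n) : fourier (fun x => a • f x) l = a • fourier f l := by
  simp only [fourier, smul_comm _ a, ← Finset.smul_sum]

open Classical in
/-- Normalized vectors that describe Eve's states, whose spectral weights are the probabilities of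
the error strings in the inverted-INFO-basis protocol. -/
theorem Attack.exists_normalized_states (A : Attack N H) (r m : ℕ)
    (law : PMF (Bits N × InfoString N n)) (b : Bits N) (s : InfoString N n)
    (iT jT : Bits (N - n)) (hpos : 0 < prob .real r m law A.sym (publicEvent r m iT jT b s)) :
    ∃ e : Bits n → Bits n → Composite H (Bits N),
      (∀ c a, ∃ τ : Composite H (Bits N) →ₗᵢ[ℂ] Composite H (Bits N),
        ∀ x, e c (x + a) = τ (e c x)) ∧
      (∀ x, ∑ c, ‖e c x‖ ^ 2 = 1) ∧
      (∀ x, A.sym.eveState b s iT jT x = ∑ c, InnerProductSpace.rankOne ℂ (e c x) (e c x)) ∧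
      ∀ t, condProb .invertedInfoBasis r m law A.sym (infoErrorEvent N n r m t)
        (publicEvent r m iT jT b s) = ∑ l : Bits n with t ≤ hammingNorm l, spectralWeight e l := by
  set p := A.sym.testProb b s iT jT 0 with hp
  have hpx : ∀ x, A.sym.testProb b s iT jT x = p := fun x => A.sym_testProb_eq b s iT jT x 0
  have hprob : ∀ v, prob v r m law A.sym (publicEvent r m iT jT b s) =
      (1 / 2 ^ N) * (law (b, s)).toReal * (∑ _P : KeyMatrices n r m, keyMatricesProb n r m) *
        ∑ x, ∑ y, if True then
          A.sym.measureProb (v.usedBasis b s) (s.merge x iT) (s.merge y jT) else 0 := fun v => by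
    have h := prob_inter_publicEvent v r m law A.sym b s iT jT (fun _ _ => True)
    rw [show ({_ω : Outcome N n r m | True} : Set (Outcome N n r m)) = Set.univ from rfl,
      Set.univ_inter] at h
    simpa using h
  have hQ := fun Q => prob_inter_publicEvent .invertedInfoBasis r m law A.sym b s iT jT Q
  set κ : ℝ := (1 / 2 ^ N) * (law (b, s)).toReal *
    (∑ _P : KeyMatrices n r m, keyMatricesProb n r m)
  have hreal : prob .real r m law A.sym (publicEvent r m iT jT b s) = κ * (2 ^ n * p) := by
    rw [hprob]
    congr 1
    simp only [if_true, Version.usedBasis]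
    have : ∀ x, ∑ y, A.sym.measureProb b (s.merge x iT) (s.merge y jT) = p := hpx
    simp [this, ZMod.card]
  rw [hreal] at hpos
  have hp0 : 0 ≤ p := Finset.sum_nonneg fun _ _ => sq_nonneg _
  have hκ : κ ≠ 0 := fun h => by simp [h] at hpos
  have hp' : 0 < p := hp0.lt_of_ne fun h => by simp [← h] at hpos
  have hsq : ‖((√p : ℝ) : ℂ)⁻¹‖ ^ 2 = p⁻¹ := by
    rw [norm_inv, Complex.norm_real, Real.norm_eq_abs, inv_pow, sq_abs, Real.sq_sqrt hp0]
  have hone : ∀ x, ∑ c, ‖((√p : ℝ) : ℂ)⁻¹ • A.sym.infoProbeState b s iT jT c x‖ ^ 2 = 1 := by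
    intro x
    simp only [norm_smul, mul_pow, hsq, ← Finset.mul_sum]
    rw [← testProb_eq, hpx, inv_mul_cancel₀ hp'.ne']
  refine ⟨fun c x => ((√p : ℝ) : ℂ)⁻¹ • A.sym.infoProbeState b s iT jT c x, ?_, hone, ?_, ?_⟩
  · intro c a
    obtain ⟨τ, hτ⟩ := A.sym_infoProbeState_translate b s iT jT c a
    exact ⟨τ, fun x => by simp only [hτ, map_smul]⟩
  · intro x
    rw [eveState, ← Equiv.sum_comp (Equiv.addLeft x)]
    refine Finset.sum_congr rfl fun c _ => ?_
    simp only [condProbeState, hpx]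
    rfl
  · intro t
    set e : Bits n → Bits n → Composite H (Bits N) :=
      fun c x => ((√p : ℝ) : ℂ)⁻¹ • A.sym.infoProbeState b s iT jT c x
    have hw : ∀ l, ∑ x, A.sym.measureProb (b + s.1) (s.merge x iT) (s.merge (x + l) jT) =
        2 ^ n * p * spectralWeight e l := by
      intro l
      rw [sum_measureProb_add_merge, spectralWeight, mul_assoc]
      congr 1
      simp only [e, fourier_smul, norm_smul, mul_pow, hsq, ← Finset.mul_sum]
      rw [← mul_assoc, mul_inv_cancel₀ hp'.ne', one_mul]
    have hsum : ∀ Q : Bits n → Prop, (∑ x, ∑ y, if Q (x + y) then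
        A.sym.measureProb (b + s.1) (s.merge x iT) (s.merge y jT) else 0) =
        2 ^ n * p * ∑ l : Bits n with Q l, spectralWeight e l := by
      intro Q
      rw [Finset.sum_filter, Finset.mul_sum]
      calc _ = ∑ x, ∑ l, if Q l then
            A.sym.measureProb (b + s.1) (s.merge x iT) (s.merge (x + l) jT) else 0 := by
            refine Finset.sum_congr rfl fun x _ => ?_
            rw [← Equiv.sum_comp (Equiv.addLeft x)]
            refine Finset.sum_congr rfl fun l _ => ?_
            rw [Equiv.coe_addLeft, ← add_assoc, bits_add_self, zero_add]
        _ = _ := by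
            rw [Finset.sum_comm]
            refine Finset.sum_congr rfl fun l _ => ?_
            split_ifs
            · exact hw l
            · simp
    have hnum : prob .invertedInfoBasis r m law A.sym
        (infoErrorEvent N n r m t ∩ publicEvent r m iT jT b s) =
        κ * (2 ^ n * p * ∑ l : Bits n with t ≤ hammingNorm l, spectralWeight e l) := by
      refine (hQ fun x y => t ≤ hammingNorm (x + y)).trans (congrArg (κ * ·) ?_)
      refine Eq.trans ?_ ((hsum fun l => t ≤ hammingNorm l).trans ?_) <;> congr!
    -- The total spectral weight is 1, so the conditioning event is as likely in the inverted
    -- protocol as in the real one.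
    have hden : prob .invertedInfoBasis r m law A.sym (publicEvent r m iT jT b s) =
        κ * (2 ^ n * p) := by
      rw [hprob]
      refine congrArg (κ * ·) (Eq.trans (by congr!) ((hsum fun _ => True).trans ?_))
      rw [Finset.filter_true, sum_spectralWeight e hone, mul_one]
    rw [condProb, hnum, hden, ← mul_assoc, mul_div_cancel_left₀ _ hpos.ne']

end Sym

/-! ### Distance between the states of two keys -/

section KeyState

variable {N n r m : ℕ} {K : Type*} [NormedAddCommGroup K] [InnerProductSpace ℂ K]

theorem isSelfAdjoint_keyState [CompleteSpace K] (A : Attack N K) (b : Bits N)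
    (s : InfoString N n) (iT jT : Bits (N - n)) (ξ : Bits r) (k : Bits m) :
    IsSelfAdjoint (keyState A b s iT jT ξ k) := by
  have hreal : ∀ a : ℝ, IsSelfAdjoint (a : ℂ) := fun a => Complex.conj_ofReal a
  have hu : ∀ (u : K) (P : KeyMatrices n r m),
      IsSelfAdjoint (tensorProj (InnerProductSpace.rankOne ℂ u u) P) := by
    intro u P
    rw [tensorProj_rankOne]
    exact (InnerProductSpace.isPositive_rankOne_self _).isSelfAdjoint
  rw [keyState]
  apply IsSelfAdjoint.smul
  · simpa using hreal ((2 : ℝ) ^ (n - r - m))⁻¹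
  apply isSelfAdjoint_sum_operator
  intro P _
  apply isSelfAdjoint_sum_operator
  intro x _
  apply IsSelfAdjoint.smul (hreal _)
  rw [Attack.eveState, tensorProj_sum]
  apply isSelfAdjoint_sum_operator
  exact fun j _ => hu _ P

/-- For each `P`, the truncated states have the same sum over the fibers of `k` and `k'` and drop
out of the difference. Each of the two remainders costs `2 √w` per string; the fiber size cancels
the normalization, leaving the constant 4. -/
theorem nuclearBound_keyState_sub (A : Attack N K) (b : Bits N) (s : InfoString N n)
    (iT jT : Bits (N - n)) (ξ : Bits r) (k k' : Bits m) (t : ℕ) {e : Bits n → Bits n → K}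
    (hτ : ∀ c a, ∃ τ : K →ₗᵢ[ℂ] K, ∀ x, e c (x + a) = τ (e c x))
    (h1 : ∀ x, ∑ c, ‖e c x‖ ^ 2 = 1)
    (hE : ∀ x, A.eveState b s iT jT x = ∑ c, InnerProductSpace.rankOne ℂ (e c x) (e c x)) :
    NuclearBound (keyState A b s iT jT ξ k - keyState A b s iT jT ξ k')
      (4 * ∑ P : KeyMatrices n r m, keyMatricesProb n r m *
        √(∑ l ∈ (P.leaders t)ᶜ, spectralWeight e l)) := by
  set D := (2 : ℝ) ^ (n - r - m) with hD
  have hD0 : 0 < D := by positivity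
  set q := keyMatricesProb n r m
  have hq : 0 ≤ q := keyMatricesProb_nonneg n r m
  -- The truncation may vary with `P` because the register holding `P` makes the key state block
  -- diagonal.
  let σ : KeyMatrices n r m → Bits n → K →L[ℂ] K := fun P x =>
    ∑ c, InnerProductSpace.rankOne ℂ (fourierPart (P.leaders t) (e c) x)
      (fourierPart (P.leaders t) (e c) x)
  have hσ : ∀ P, ∑ x ∈ P.fiber ξ k, σ P x = ∑ x ∈ P.fiber ξ k', σ P x := by
    intro P
    have hG : ∀ l ∈ P.leaders t, ∀ l' ∈ P.leaders t, l + l' ∈ P.rowSpan → l = l' := by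
      intro l hl l' hl'
      exact (KeyMatrices.mem_leaders.1 hl).2 l' (KeyMatrices.mem_leaders.1 hl').1
    simp only [σ]
    rw [Finset.sum_comm, Finset.sum_comm (s := P.fiber ξ k')]
    exact Finset.sum_congr rfl fun c _ => by
      rw [sum_rankOne_fourierPart P ξ k _ hG, sum_rankOne_fourierPart P ξ k' _ hG]
  have hdiff : keyState A b s iT jT ξ k - keyState A b s iT jT ξ k' =
      ((D⁻¹ : ℝ) : ℂ) • ∑ P : KeyMatrices n r m, (q : ℂ) • tensorProj
        (∑ x ∈ P.fiber ξ k, (A.eveState b s iT jT x - σ P x) -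
          ∑ x ∈ P.fiber ξ k', (A.eveState b s iT jT x - σ P x)) P := by
    have hk : ∀ k, keyState A b s iT jT ξ k = ((D⁻¹ : ℝ) : ℂ) • ∑ P : KeyMatrices n r m, (q : ℂ) •
        tensorProj (∑ x ∈ P.fiber ξ k, A.eveState b s iT jT x) P := by
      intro k
      simp only [tensorProj_sum, Finset.smul_sum (s := KeyMatrices.fiber _ ξ k)]
      rw [hD, Complex.ofReal_inv, Complex.ofReal_pow]
      rfl
    rw [hk, hk]
    refine (smul_sub _ _ _).symm.trans (congrArg _ ?_)
    refine (Finset.sum_sub_distrib _ _).symm.trans (Finset.sum_congr rfl fun P _ => ?_)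
    refine (smul_sub _ _ _).symm.trans (congrArg _ ?_)
    rw [← tensorProj_sub, Finset.sum_sub_distrib, Finset.sum_sub_distrib, hσ,
      sub_sub_sub_cancel_right]
  rw [hdiff]
  have hone : ∀ (P : KeyMatrices n r m) (k : Bits m),
      NuclearBound (∑ x ∈ P.fiber ξ k, (A.eveState b s iT jT x - σ P x))
        (D * (2 * √(∑ l ∈ (P.leaders t)ᶜ, spectralWeight e l))) := by
    intro P k
    refine (NuclearBound.sum _ _ (fun _ => 2 * √(∑ l ∈ (P.leaders t)ᶜ, spectralWeight e l))
      fun x _ => ?_).mono (le_of_eq ?_)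
    · rw [hE]
      exact nuclearBound_sub_fourierPart hτ h1 _ x
    · rw [Finset.sum_const, P.card_fiber, nsmul_eq_mul, hD]
      norm_cast
  refine ((NuclearBound.sum _ _ _ fun P _ =>
    (((hone P k).sub (hone P k')).tensorProj P).smul _).smul _).mono (le_of_eq ?_)
  rw [Finset.mul_sum, Finset.mul_sum]
  refine Finset.sum_congr rfl fun P _ => ?_
  rw [Complex.norm_real, Complex.norm_real, Real.norm_of_nonneg hq,
    Real.norm_of_nonneg (inv_nonneg.2 hD0.le)]
  field_simp
  ring

end KeyState

/-! ### Averaging over the matrices and conclusion -/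

/-- Concavity of the square root under a measure of mass at most 1, by Cauchy–Schwarz after writing
`q` as `√q * √q`. -/
theorem sum_mul_sqrt_le {α : Type*} (F : Finset α) (q : ℝ) (hq : 0 ≤ q) (hq1 : ∑ _a ∈ F, q ≤ 1)
    (ε : α → ℝ) (hε : ∀ a, 0 ≤ ε a) : ∑ a ∈ F, q * √(ε a) ≤ √(∑ a ∈ F, q * ε a) := by
  calc ∑ a ∈ F, q * √(ε a) = ∑ a ∈ F, √q * √(q * ε a) := by
        refine Finset.sum_congr rfl fun a _ => ?_
        rw [Real.sqrt_mul hq, ← mul_assoc, Real.mul_self_sqrt hq]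
    _ ≤ √(∑ a ∈ F, √q ^ 2) * √(∑ a ∈ F, √(q * ε a) ^ 2) := Real.sum_mul_le_sqrt_mul_sqrt _ _ _
    _ ≤ 1 * √(∑ a ∈ F, q * ε a) := by
        simp only [Real.sq_sqrt hq, fun a => Real.sq_sqrt (mul_nonneg hq (hε a))]
        exact mul_le_mul_of_nonneg_right (Real.sqrt_le_one.2 hq1) (Real.sqrt_nonneg _)
    _ = _ := one_mul _

theorem card_hammingNorm_lt_mul_le {n r m t : ℕ} (hn : 0 < n) (ht : (t : ℝ) ≤ (n : ℝ) / 2) :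
    ((Finset.univ.filter fun x : Bits n => hammingNorm x < t).card : ℝ) *
      ((2 : ℝ) ^ (r + m) / 2 ^ n) ≤
      (2 : ℝ) ^ ((n : ℝ) * (H₂ ((t : ℝ) / n) - ((n : ℝ) - r - m) / n)) := by
  have hn' : (n : ℝ) ≠ 0 := by exact_mod_cast hn.ne'
  have h : (n : ℝ) * (H₂ ((t : ℝ) / n) - ((n : ℝ) - r - m) / n) =
      n * H₂ ((t : ℝ) / n) + (((r + m : ℕ) : ℝ) - n) := by
    push_cast
    field_simp
    ring
  rw [h, Real.rpow_add two_pos, Real.rpow_sub two_pos, Real.rpow_natCast, Real.rpow_natCast]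
  exact mul_le_mul_of_nonneg_right (card_hammingNorm_lt_le hn ht) (by positivity)

end BB84

end

theorem mainTheorem5 {H : Type*} [NormedAddCommGroup H] [InnerProductSpace ℂ H] [CompleteSpace H]
    (N n r m : ℕ) (hrm : r + m ≤ n) (hnN : n < N)
    (law : PMF (BB84.Bits N × BB84.InfoString N n)) (A : BB84.Attack N H)
    (b : BB84.Bits N) (s : BB84.InfoString N n) (iT jT : BB84.Bits (N - n))
    (hpos : 0 < BB84.prob .real r m law A.sym (BB84.publicEvent r m iT jT b s))
    (ξ : BB84.Bits r) (k k' : BB84.Bits m) (t : ℕ) (ht : (t : ℝ) ≤ (n : ℝ) / 2) :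
    (1 / 2) * BB84.traceNorm
        (BB84.keyState A.sym b s iT jT ξ k - BB84.keyState A.sym b s iT jT ξ k') ≤
      ENNReal.ofReal (2 * (m : ℝ) * Real.sqrt
        (BB84.condProb .invertedInfoBasis r m law A.sym (BB84.infoErrorEvent N n r m t)
            (BB84.publicEvent r m iT jT b s) +
          (2 : ℝ) ^ ((n : ℝ) * (BB84.H₂ ((t : ℝ) / n) - ((n : ℝ) - r - m) / n)))) := by
  have hsa : IsSelfAdjoint
      (BB84.keyState A.sym b s iT jT ξ k - BB84.keyState A.sym b s iT jT ξ k') := by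
    apply BB84.isSelfAdjoint_sub_operator <;> exact BB84.isSelfAdjoint_keyState A.sym b s iT jT ξ _
  -- For `m = 0` there is only one key. For `m > 0`, `r + m ≤ n` forces `n > 0`, as the entropy
  -- bound requires.
  rcases Nat.eq_zero_or_pos m with rfl | hm
  · have hk : BB84.keyState A.sym b s iT jT ξ k - BB84.keyState A.sym b s iT jT ξ k' = 0 := by
      rw [Subsingleton.elim k k', sub_self]
    rw [hk, BB84.traceNorm_zero, mul_zero]
    exact zero_le
  obtain ⟨e, hτ, h1, hE, hC⟩ := A.exists_normalized_states r m law b s iT jT hpos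
  have hT := (BB84.nuclearBound_keyState_sub A.sym b s iT jT ξ k k' t hτ h1 hE).traceNorm_le hsa
  rw [hC]
  set R := ∑ P : BB84.KeyMatrices n r m, BB84.keyMatricesProb n r m *
    √(∑ l ∈ (P.leaders t)ᶜ, BB84.spectralWeight e l)
  set Z := (∑ l : BB84.Bits n with t ≤ hammingNorm l, BB84.spectralWeight e l) +
    (2 : ℝ) ^ ((n : ℝ) * (BB84.H₂ ((t : ℝ) / n) - ((n : ℝ) - r - m) / n))
  have hR : R ≤ √Z := by
    refine (BB84.sum_mul_sqrt_le _ _ (BB84.keyMatricesProb_nonneg n r m)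
      (BB84.sum_keyMatricesProb_le n r m) _ fun P => Finset.sum_nonneg fun l _ =>
        BB84.spectralWeight_nonneg e l).trans (Real.sqrt_le_sqrt ?_)
    refine (BB84.sum_spectralWeight_compl_leaders_le h1 t).trans ?_
    refine add_le_add (le_of_eq ?_) (BB84.card_hammingNorm_lt_mul_le (by omega) ht)
    congr!
  have hhalf : (1 / 2 : ℝ≥0∞) = ENNReal.ofReal (1 / 2) := by
    rw [ENNReal.ofReal_div_of_pos two_pos]
    simp
  calc (1 / 2 : ℝ≥0∞) * BB84.traceNorm
        (BB84.keyState A.sym b s iT jT ξ k - BB84.keyState A.sym b s iT jT ξ k')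
      ≤ ENNReal.ofReal (1 / 2) * ENNReal.ofReal (4 * R) := by
        rw [hhalf]
        gcongr
    _ = ENNReal.ofReal (2 * R) := by
        rw [← ENNReal.ofReal_mul (by norm_num)]
        congr 1
        ring
    _ ≤ ENNReal.ofReal (2 * (m : ℝ) * √Z) := by
        refine ENNReal.ofReal_le_ofReal ?_
        -- The estimate obtained is `2 √Z`; the factor `m` only weakens it.
        have hm1 : (1 : ℝ) ≤ m := by exact_mod_cast hm
        have hZ := Real.sqrt_nonneg Z
        nlinarith
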